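/- Let $\Sigma$ be a finite family of nondegenerate simplices of $\mathbb{R}^d$, let $d_\sigma$ be the dimension of $\sigma\in\Sigma$ and $K=\bigcup_{\sigma\in\Sigma}\sigma$. Let $\mu$ be the probability measure $\mu(B)=\sum_{\sigma\in\Sigma}\int_{B\cap\sigma}\rho_\sigma\,d\mathcal{H}^{d_\sigma}$, and assume that it is regular: $d_\sigma\ge 2$ for all $\sigma$; every $\rho_\sigma:\sigma\to\mathbb{R}$ is continuous with $\min_\sigma\rho_\sigma>0$; and $K\setminus S$ is connected for every finite $S\subseteq K$. Let $y_1,\dots,y_N\in\mathbb{R}^d$ be in generic position with respect to every simplex $\sigma=[x_0,\dots,x_k]\in\Sigma$, i.e. for all integers $1\le p\le k$ and $1\le \ell\le\min(d,N-1)$, all distinct $i_0,\dots,i_\ell\in\{1,\dots,N\}$ and all distinct $j_0,\dots,j_p\in\{0,\dots,k\}$, $$\dim\bigl(\{y_{i_1}-y_{i_0},\dots,y_{i_\ell}-y_{i_0}\}^\perp\cap\mathrm{vect}(x_{j_1}-x_{j_0},\dots,x_{j_p}-x_{j_0})\bigr)=\max(p-\ell,0).$$ For $\psi\in\mathbb{R}^N$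 put $\mathrm{Lag}_i(\psi)=\{x\in K: \|x-y_i\|^2+\psi_i\le\|x-y_j\|^2+\psi_j\ \forall j\}$, $G_i(\psi)=\mu(\mathrm{Lag}_i(\psi))$ and $G=(G_1,\dots,G_N)$. Let $\nu\in\mathbb{R}^N$ with $\nu_i\ge 0$ and $\sum_i\nu_i=1$. All norms are Euclidean. Given $\psi^0\in\mathbb{R}^N$ such that $\varepsilon_0:=\tfrac12\min\bigl(\min_iG_i(\psi^0),\min_i\nu_i\bigr)>0$ and a tolerance $\eta>0$, the damped Newton algorithm does the following while $\|G(\psi^k)-\nu\|\ge\eta$: it computes $v^k=-DG(\psi^k)^+(G(\psi^k)-\nu)$, where $A^+$ is the Moore–Penrose pseudo-inverse of $A$; it determines the least $\ell\in\mathbb{N}$ such that $\psi^{k,\ell}=\psi^k+2^{-\ell}v^k$ satisfies $$\min_iG_i(\psi^{k,\ell})\ge\varepsilon_0\quad\text{and}\quad\|G(\psi^{k,\ell})-\nu\|\le(1-2^{-(\ell+1)})\|G(\psi^k)-\nu\|;$$ and it sets $\psi^{k+1}=\psi^{k,\ell}$ for this $\ell$. Then every step of the algorithm is well defined ($G$ is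 differentiable at the iterates and the required $\ell$ exists), and the algorithm stops after finitely many steps, at an iterate with $\|G(\psi^k)-\nu\|<\eta$. Moreover there is $\tau^*\in(0,1]$, depending only on $\mu$, $\nu$ (including the points $y_i$) and $\varepsilon_0$, and not on $\psi^0$ or $\eta$ otherwise, such that all iterates satisfy $$\|G(\psi^{k+1})-\nu\|\le\Bigl(1-\frac{\tau^*}{2}\Bigr)\|G(\psi^k)-\nu\|.$$ -/

import Mathlib

open MeasureTheory Set
open scoped ENNReal

noncomputable section

namespace SemiDiscrete

/-- A simplex soup in `ℝ^d`: a finite family (the index type is finite wherever this is used) of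
nondegenerate simplices, possibly of different dimensions. -/
structure SimplexSoup (d : ℕ) (ι : Type*) where
  /-- the dimension `d_σ` of each simplex -/
  dim : ι → ℕ
  /-- the simplices, given by their affinely independent vertices -/
  simplex : (s : ι) → Affine.Simplex ℝ (EuclideanSpace ℝ (Fin d)) (dim s)

namespace SimplexSoup

variable {d : ℕ} {ι : Type*} (S : SimplexSoup d ι)

/-- The simplex `σ = [x₀, …, x_k]` as a closed convex subset of `ℝ^d`. -/
def cell (s : ι) : Set (EuclideanSpace ℝ (Fin d)) :=
  convexHull ℝ (Set.range (S.simplex s).points)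

/-- The support `K` of the soup: the union of its simplices. -/
def support : Set (EuclideanSpace ℝ (Fin d)) := ⋃ s, S.cell s

end SimplexSoup

/-- The data of a simplicial measure: a simplex soup and a nonnegative density on each simplex. -/
structure SimplicialMeasure (d : ℕ) (ι : Type*) where
  /-- the underlying soup -/
  soup : SimplexSoup d ι
  /-- the densities `ρ_σ`; only their values on the simplex matter -/
  density : ι → EuclideanSpace ℝ (Fin d) → ℝ
  measurable_density : ∀ s, Measurable ((soup.cell s).domRestrict (density s))
  density_nonneg : ∀ s, ∀ x ∈ soup.cell s, 0 ≤ density s x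

namespace SimplicialMeasure

variable {d : ℕ} {ι : Type*} (M : SimplicialMeasure d ι)

/-- The measure `B ↦ ∑_σ ∫_{B ∩ σ} ρ_σ dℋ^{d_σ}`. Here `μHE[k]` is the `k`-dimensional Hausdorff
measure with the usual normalisation (it agrees with Lebesgue measure on `ℝ^k`). -/
def toMeasure [Fintype ι] : Measure (EuclideanSpace ℝ (Fin d)) :=
  ∑ s, ((μHE[M.soup.dim s]).restrict (M.soup.cell s)).withDensity
    (fun x => ENNReal.ofReal (M.density s x))

/-- Regular simplicial measures. -/
structure IsRegular : Prop where
  two_le_dim : ∀ s, 2 ≤ M.soup.dim s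
  continuousOn_density : ∀ s, ContinuousOn (M.density s) (M.soup.cell s)
  density_pos : ∀ s, ∃ c : ℝ, 0 < c ∧ ∀ x ∈ M.soup.cell s, c ≤ M.density s x
  isConnected_diff : ∀ F : Set (EuclideanSpace ℝ (Fin d)), F ⊆ M.soup.support → F.Finite →
    IsConnected (M.soup.support \ F)

end SimplicialMeasure

/-- The points `y₁, …, y_N` are in generic position with respect to the `k`-simplex with vertices
`x₀, …, x_k`. The subtraction `p - l` is truncated, i.e. it is `max (p - l) 0`. -/
def IsGenericFor {d N k : ℕ} (y : Fin N → EuclideanSpace ℝ (Fin d))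
    (σ : Affine.Simplex ℝ (EuclideanSpace ℝ (Fin d)) k) : Prop :=
  ∀ p l : ℕ, 1 ≤ p → p ≤ k → 1 ≤ l → l ≤ min d (N - 1) →
    ∀ (i : Fin (l + 1) → Fin N) (j : Fin (p + 1) → Fin (k + 1)),
      Function.Injective i → Function.Injective j →
      Module.finrank ℝ
        ↥((Submodule.span ℝ (Set.range fun a : Fin l => y (i a.succ) - y (i 0)))ᗮ ⊓
          Submodule.span ℝ
            (Set.range fun b : Fin p => σ.points (j b.succ) - σ.points (j 0))) = p - l

/-- Generic position with respect to all simplices of a soup. -/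
def IsGeneric {d N : ℕ} {ι : Type*} (y : Fin N → EuclideanSpace ℝ (Fin d))
    (S : SimplexSoup d ι) : Prop :=
  ∀ s, IsGenericFor y (S.simplex s)

/-- The `i`-th power cell of the points `y` with weights `ψ`. -/
def powerCell {d N : ℕ} (y : Fin N → EuclideanSpace ℝ (Fin d)) (ψ : EuclideanSpace ℝ (Fin N))
    (i : Fin N) : Set (EuclideanSpace ℝ (Fin d)) :=
  {x | ∀ j, ‖x - y i‖ ^ 2 + ψ i ≤ ‖x - y j‖ ^ 2 + ψ j}

/-- The `i`-th Laguerre cell: the part of the power cell that lies in the support of the soup. -/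
def laguerreCell {d N : ℕ} {ι : Type*} (S : SimplexSoup d ι)
    (y : Fin N → EuclideanSpace ℝ (Fin d)) (ψ : EuclideanSpace ℝ (Fin N)) (i : Fin N) :
    Set (EuclideanSpace ℝ (Fin d)) :=
  powerCell y ψ i ∩ S.support

/-- The map `G : ℝ^N → ℝ^N`, `G_i(ψ) = μ(Lag_i(ψ))`. -/
def massMap {d N : ℕ} {ι : Type*} [Fintype ι] (M : SimplicialMeasure d ι)
    (y : Fin N → EuclideanSpace ℝ (Fin d)) (ψ : EuclideanSpace ℝ (Fin N)) :
    EuclideanSpace ℝ (Fin N) :=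
  WithLp.toLp 2 fun i => M.toMeasure.real (laguerreCell M.soup y ψ i)

/-- `B` is the (Moore–Penrose) pseudo-inverse `A⁺` of `A`: the four Penrose equations, which
determine `B`. -/
structure IsPseudoInverse {N : ℕ}
    (A B : EuclideanSpace ℝ (Fin N) →L[ℝ] EuclideanSpace ℝ (Fin N)) : Prop where
  mul_mul_left : A * B * A = A
  mul_mul_right : B * A * B = B
  isSelfAdjoint_left : IsSelfAdjoint (A * B)
  isSelfAdjoint_right : IsSelfAdjoint (B * A)

section Algorithm

variable {N : ℕ} (G : EuclideanSpace ℝ (Fin N) → EuclideanSpace ℝ (Fin N))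
  (ν : EuclideanSpace ℝ (Fin N)) (ε₀ : ℝ)

/-- `v` is the Newton direction `-DG(ψ)⁺ (G(ψ) - ν)`; in particular `G` is differentiable
at `ψ`. -/
def IsNewtonDirection (ψ v : EuclideanSpace ℝ (Fin N)) : Prop :=
  ∃ A B : EuclideanSpace ℝ (Fin N) →L[ℝ] EuclideanSpace ℝ (Fin N),
    HasFDerivAt G A ψ ∧ IsPseudoInverse A B ∧ v = -B (G ψ - ν)

/-- The exponents `ℓ` for which the damped step `ψ + 2^{-ℓ} v` is acceptable. -/
def admissibleExponents (ψ v : EuclideanSpace ℝ (Fin N)) : Set ℕ :=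
  {l | (∀ i, ε₀ ≤ G (ψ + (2⁻¹ : ℝ) ^ l • v) i) ∧
    ‖G (ψ + (2⁻¹ : ℝ) ^ l • v) - ν‖ ≤ (1 - (2⁻¹ : ℝ) ^ (l + 1)) * ‖G ψ - ν‖}

/-- One pass through the loop of the damped Newton algorithm: the next iterate is
`ψ' = ψ + 2^{-ℓ} v`, with `v` the Newton direction and `ℓ` the least acceptable exponent. -/
def IsDampedNewtonStep (ψ ψ' : EuclideanSpace ℝ (Fin N)) : Prop :=
  ∃ (v : EuclideanSpace ℝ (Fin N)) (l : ℕ), IsNewtonDirection G ν ψ v ∧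
    IsLeast (admissibleExponents G ν ε₀ ψ v) l ∧ ψ' = ψ + (2⁻¹ : ℝ) ^ l • v

/-- `ψ 0, …, ψ T` are the first iterates of the damped Newton algorithm started at `ψ₀` with
tolerance `η`: the loop is executed at each `ψ k`, `k < T`, the loop condition being satisfied
there. Nothing is said about `ψ k` for `k > T`. -/
def IsDampedNewtonRun (η : ℝ) (ψ₀ : EuclideanSpace ℝ (Fin N)) (T : ℕ)
    (ψ : ℕ → EuclideanSpace ℝ (Fin N)) : Prop :=
  ψ 0 = ψ₀ ∧ ∀ k < T, η ≤ ‖G (ψ k) - ν‖ ∧ IsDampedNewtonStep G ν ε₀ (ψ k) (ψ (k + 1))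

end Algorithm

end SemiDiscrete

end

open SemiDiscrete

/-!
In an affine chart of a simplex, a Laguerre cell is a polyhedron cut out by fixed linear forms with
offsets that are affine in `ψ`. By Fubini, the derivative of the integral of a continuous function
over a polyhedron with respect to an offset is an integral over the corresponding facet, and it is
continuous in the offsets as long as no two of the linear forms are proportional. Generic position
provides this independence for simplices of dimension at least `2`, so `G` is `C¹`, and
`DG(ψ)` is the Laplacian of a weighted graph on the indices `i`, with an edge between `i` and `j` as
soon as their cells meet in the relative interior of a simplex away from the other cells.

If all `G_i(ψ)` are positive, this graph is connected: the cells of two complementary sets of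
indices cover `K`, so they meet in infinitely many points because no finite set disconnects `K`,
and generic position turns a common point outside a finite set into an edge. Hence the kernel of
`DG(ψ)` consists of the constant vectors only.

Modulo constants the set of `ψ` with `G_i(ψ) ≥ ε₀` for all `i` is compact. The Newton directions are
therefore bounded there by a multiple of `‖G(ψ) - ν‖` and `G` is uniformly differentiable, which
makes every sufficiently small damping admissible, with a bound that does not depend on `ψ`.
-/

namespace SemiDiscrete

open Filter Topology

section PseudoInverse

variable {N : ℕ} {A B C : EuclideanSpace ℝ (Fin N) →L[ℝ] EuclideanSpace ℝ (Fin N)}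

theorem exists_isPseudoInverse (A : EuclideanSpace ℝ (Fin N) →L[ℝ] EuclideanSpace ℝ (Fin N)) :
    ∃ B, IsPseudoInverse A B := by
  let W := A.kerᗮ
  let e : W ≃ₗ[ℝ] A.range := A.toLinearMap.kerComplementEquivRange
    (Submodule.isCompl_orthogonal A.ker).symm
  let B := W.subtypeL ∘L (e.symm.toContinuousLinearEquiv : A.range →L[ℝ] W) ∘L
    A.range.orthogonalProjectionOnto
  have hAW : ∀ x, A (W.starProjection x) = A x := fun x => by
    have : x - W.starProjection x ∈ A.ker := by
      simp [W]
    rw [← sub_eq_zero, ← map_sub, ← neg_sub, map_neg, neg_eq_zero]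
    exact this
  have hAB : A * B = A.range.starProjection := by
    ext1 x
    exact congrArg Subtype.val (e.apply_symm_apply (A.range.orthogonalProjectionOnto x))
  have hBA : B * A = W.starProjection := by
    ext1 x
    have : A.range.orthogonalProjectionOnto (A x) = e (W.orthogonalProjectionOnto x) :=
      (A.range.orthogonalProjectionOnto_mem_subspace_eq_self ⟨A x, x, rfl⟩).trans
        (Subtype.ext (hAW x).symm)
    change ((e.symm (A.range.orthogonalProjectionOnto (A x)) : W) : EuclideanSpace ℝ (Fin N)) = _
    rw [this, e.symm_apply_apply]
    rfl
  refine ⟨B, ?_, ?_, ?_, ?_⟩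
  · rw [mul_assoc, hBA]
    exact ContinuousLinearMap.ext hAW
  · rw [hBA]
    ext1 x
    exact W.starProjection_eq_self_iff.2 (Subtype.prop _)
  · rw [hAB]
    exact isSelfAdjoint_starProjection _
  · rw [hBA]
    exact isSelfAdjoint_starProjection _

theorem IsPseudoInverse.unique (hB : IsPseudoInverse A B) (hC : IsPseudoInverse A C) : B = C := by
  have hAB : A * B = A * C := by
    calc A * B = star (A * C * (A * B)) := by
          rw [← mul_assoc, hC.mul_mul_left, hB.isSelfAdjoint_left.star_eq]
      _ = A * B * (A * C) := by
          rw [star_mul, hB.isSelfAdjoint_left.star_eq, hC.isSelfAdjoint_left.star_eq]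
      _ = A * C := by rw [← mul_assoc, hB.mul_mul_left]
  have hBA : B * A = C * A := by
    calc B * A = star (B * A * (C * A)) := by
          rw [mul_assoc B, ← mul_assoc A, hC.mul_mul_left, hB.isSelfAdjoint_right.star_eq]
      _ = C * A * (B * A) := by
          rw [star_mul, hB.isSelfAdjoint_right.star_eq, hC.isSelfAdjoint_right.star_eq]
      _ = C * A := by rw [mul_assoc, ← mul_assoc A, hB.mul_mul_left]
  rw [← hB.mul_mul_right, hBA, mul_assoc, hAB, ← mul_assoc, hC.mul_mul_right]

theorem IsPseudoInverse.apply_apply_of_mem_range (hB : IsPseudoInverse A B)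
    {w : EuclideanSpace ℝ (Fin N)} (hw : w ∈ A.range) : A (B w) = w := by
  obtain ⟨x, rfl⟩ := hw
  exact congr($hB.mul_mul_left x)

theorem IsPseudoInverse.apply_mem_orthogonal_ker (hB : IsPseudoInverse A B)
    (w : EuclideanSpace ℝ (Fin N)) : B w ∈ A.kerᗮ := by
  intro u hu
  have hsymm := ContinuousLinearMap.isSelfAdjoint_iff_isSymmetric.1 hB.isSelfAdjoint_right
  have hu : A u = 0 := hu
  calc inner ℝ u (B w) = inner ℝ u ((B * A) (B w)) := by
        rw [show (B * A) (B w) = B w from congr($hB.mul_mul_right w)]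
    _ = inner ℝ ((B * A) u) (B w) := (hsymm u (B w)).symm
    _ = 0 := by simp [hu]

end PseudoInverse

section Algorithm

variable {N : ℕ} {G : EuclideanSpace ℝ (Fin N) → EuclideanSpace ℝ (Fin N)}
  {ν : EuclideanSpace ℝ (Fin N)} {ε₀ : ℝ} {ψ v w φ φ' : EuclideanSpace ℝ (Fin N)}

theorem IsNewtonDirection.unique (hv : IsNewtonDirection G ν ψ v)
    (hw : IsNewtonDirection G ν ψ w) : v = w := by
  obtain ⟨A, B, hA, hB, rfl⟩ := hv
  obtain ⟨A', B', hA', hB', rfl⟩ := hw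
  obtain rfl := hA.unique hA'
  rw [hB.unique hB']

theorem IsDampedNewtonStep.unique (hφ : IsDampedNewtonStep G ν ε₀ ψ φ)
    (hφ' : IsDampedNewtonStep G ν ε₀ ψ φ') : φ = φ' := by
  obtain ⟨v, l, hv, hl, rfl⟩ := hφ
  obtain ⟨w, m, hw, hm, rfl⟩ := hφ'
  obtain rfl := hv.unique hw
  rw [hl.unique hm]

theorem exists_isNewtonDirection (hG : DifferentiableAt ℝ G ψ) (ν : EuclideanSpace ℝ (Fin N)) :
    ∃ v, IsNewtonDirection G ν ψ v := by
  obtain ⟨B, hB⟩ := exists_isPseudoInverse (fderiv ℝ G ψ)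
  exact ⟨_, _, B, hG.hasFDerivAt, hB, rfl⟩

theorem IsNewtonDirection.mem_orthogonal_ker (hv : IsNewtonDirection G ν ψ v) :
    v ∈ (fderiv ℝ G ψ).kerᗮ := by
  obtain ⟨A, B, hA, hB, rfl⟩ := hv
  rw [hA.fderiv]
  exact neg_mem (hB.apply_mem_orthogonal_ker _)

theorem IsNewtonDirection.fderiv_apply (hv : IsNewtonDirection G ν ψ v)
    (hν : G ψ - ν ∈ (fderiv ℝ G ψ).range) : fderiv ℝ G ψ v = -(G ψ - ν) := by
  obtain ⟨A, B, hA, hB, rfl⟩ := hv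
  rw [hA.fderiv] at hν ⊢
  rw [map_neg, hB.apply_apply_of_mem_range hν]

theorem exists_isDampedNewtonStep (hv : IsNewtonDirection G ν ψ v)
    (hne : (admissibleExponents G ν ε₀ ψ v).Nonempty) : ∃ φ, IsDampedNewtonStep G ν ε₀ ψ φ :=
  ⟨_, v, sInf (admissibleExponents G ν ε₀ ψ v), hv,
    ⟨Nat.sInf_mem hne, fun _ hl => Nat.sInf_le hl⟩, rfl⟩

end Algorithm

section Analysis

variable {E F : Type*} [NormedAddCommGroup E] [NormedSpace ℝ E] [NormedAddCommGroup F]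
  [NormedSpace ℝ F]

theorem exists_norm_map_add_sub_le {G : E → F} (hG : ContDiff ℝ 1 G) {K : Set E}
    (hK : IsCompact K) {ω : ℝ} (hω : 0 < ω) :
    ∃ δ > 0, ∀ x ∈ K, ∀ h, ‖h‖ < δ → ‖G (x + h) - G x - fderiv ℝ G x h‖ ≤ ω * ‖h‖ := by
  have hG' : Continuous (fderiv ℝ G) := hG.continuous_fderiv one_ne_zero
  obtain ⟨δ, hδ, hsub⟩ := Metric.mem_uniformity_dist.1 <|
    hK.uniformContinuousAt_of_continuousAt (fderiv ℝ G) (fun x _ => hG'.continuousAt)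
      (Metric.dist_mem_uniformity hω)
  refine ⟨δ, hδ, fun x hx h hh => ?_⟩
  have hderiv : ∀ z ∈ Metric.ball x δ, ‖fderiv ℝ G z - fderiv ℝ G x‖ ≤ ω := fun z hz => by
    have : dist (fderiv ℝ G x) (fderiv ℝ G z) < ω := hsub (by rwa [dist_comm]) hx
    rw [← dist_eq_norm, dist_comm]
    exact this.le
  simpa using (convex_ball x δ).norm_image_sub_le_of_norm_hasFDerivWithin_le'
    (fun z _ => (hG.differentiable one_ne_zero z).hasFDerivAt.hasFDerivWithinAt) hderiv
    (Metric.mem_ball_self hδ) (show x + h ∈ Metric.ball x δ by simpa using hh)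

theorem exists_norm_le_mul_norm_apply [FiniteDimensional ℝ E] {X : Type*} [TopologicalSpace X]
    {A : X → E →L[ℝ] F} (hA : Continuous A) {K : Set X} (hK : IsCompact K) (W : Submodule ℝ E)
    (hW : ∀ x ∈ K, ∀ v ∈ W, A x v = 0 → v = 0) :
    ∃ C > 0, ∀ x ∈ K, ∀ v ∈ W, ‖v‖ ≤ C * ‖A x v‖ := by
  have hS : IsCompact (K ×ˢ (Metric.sphere (0 : E) 1 ∩ W)) :=
    hK.prod ((isCompact_sphere _ _).inter_right W.closed_of_finiteDimensional)
  have hcont : Continuous fun p : X × E => ‖A p.1 p.2‖ := by fun_prop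
  obtain ⟨m, hm, hmin⟩ : ∃ m > 0, ∀ p ∈ K ×ˢ (Metric.sphere (0 : E) 1 ∩ W), m ≤ ‖A p.1 p.2‖ := by
    refine hS.exists_forall_le' hcont.continuousOn fun p hp => norm_pos_iff.2 fun h0 => ?_
    have := hp.2.1
    simp [hW p.1 hp.1 p.2 hp.2.2 h0] at this
  refine ⟨m⁻¹, inv_pos.2 hm, fun x hx v hv => ?_⟩
  rcases eq_or_ne v 0 with rfl | hv0
  · simp
  have hnorm : 0 < ‖v‖ := norm_pos_iff.2 hv0
  have := hmin (x, ‖v‖⁻¹ • v) ⟨hx, by simp [norm_smul, hnorm.ne'], W.smul_mem _ hv⟩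
  rw [map_smul, norm_smul, norm_inv, norm_norm, inv_mul_eq_div, le_div_iff₀ hnorm] at this
  rwa [inv_mul_eq_div, le_div_iff₀ hm, mul_comm]

theorem norm_sub_le_of_norm_sub_damped_le {x x' ν : F} {t : ℝ} (ht : t ≤ 1)
    (h : ‖x' - (x - t • (x - ν))‖ ≤ t / 2 * ‖x - ν‖) : ‖x' - ν‖ ≤ (1 - t / 2) * ‖x - ν‖ := by
  calc ‖x' - ν‖ = ‖(x' - (x - t • (x - ν))) + (1 - t) • (x - ν)‖ := by
        congr 1
        rw [sub_smul, one_smul]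
        abel
    _ ≤ ‖x' - (x - t • (x - ν))‖ + ‖(1 - t) • (x - ν)‖ := norm_add_le _ _
    _ ≤ t / 2 * ‖x - ν‖ + (1 - t) * ‖x - ν‖ := by
        rw [norm_smul, Real.norm_of_nonneg (sub_nonneg.2 ht)]
        gcongr
    _ = (1 - t / 2) * ‖x - ν‖ := by ring

theorem le_apply_of_norm_sub_damped_le {n : Type*} [Fintype n] {x x' ν : EuclideanSpace ℝ n}
    {t ε : ℝ} (ht₀ : 0 ≤ t) (ht : t ≤ 1) (h : ‖x' - (x - t • (x - ν))‖ ≤ t * ε)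
    {i : n} (hx : ε ≤ x i) (hν : 2 * ε ≤ ν i) : ε ≤ x' i := by
  have hi := (abs_le.1 ((PiLp.norm_apply_le _ i).trans h)).1
  simp only [PiLp.sub_apply, PiLp.smul_apply, smul_eq_mul] at hi
  nlinarith [mul_le_mul_of_nonneg_left hν ht₀, mul_le_mul_of_nonneg_left hx (sub_nonneg.2 ht)]

end Analysis

section Ones

variable (n : Type*)

/-- The vector `(1, …, 1)`. Weights are only determined up to its multiples, and `(ℝ ∙ ones n)ᗮ` is
the space of weights with mean zero. -/
noncomputable def ones : EuclideanSpace ℝ n := WithLp.toLp 2 fun _ => 1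

variable {n} {v : EuclideanSpace ℝ n}

@[simp]
theorem ones_apply (i : n) : ones n i = 1 := rfl

theorem mem_span_ones_iff : v ∈ ℝ ∙ ones n ↔ ∀ i j, v i = v j := by
  rw [Submodule.mem_span_singleton]
  constructor
  · rintro ⟨c, rfl⟩ i j
    simp
  · intro hv
    rcases isEmpty_or_nonempty n with h | ⟨⟨i⟩⟩
    · exact ⟨0, Subsingleton.elim _ _⟩
    · exact ⟨v i, by ext j; simp [hv i j]⟩

variable [Fintype n]

theorem mem_orthogonal_ones_iff : v ∈ (ℝ ∙ ones n)ᗮ ↔ ∑ i, v i = 0 := by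
  simp [Submodule.mem_orthogonal_singleton_iff_inner_right, PiLp.inner_apply]

theorem norm_le_one_of_nonneg_of_sum_eq_one (hv : ∀ i, 0 ≤ v i) (hsum : ∑ i, v i = 1) :
    ‖v‖ ≤ 1 := by
  rw [← sq_le_one_iff₀ (norm_nonneg v), EuclideanSpace.norm_sq_eq, ← hsum]
  gcongr with i
  rw [Real.norm_of_nonneg (hv i)]
  have : v i ≤ 1 := hsum ▸ Finset.single_le_sum (fun j _ => hv j) (Finset.mem_univ i)
  exact pow_le_of_le_one (hv i) this two_ne_zero

theorem abs_apply_le_of_mem_orthogonal_ones (hv : v ∈ (ℝ ∙ ones n)ᗮ) {R : ℝ}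
    (hR : ∀ i j, v i - v j ≤ R) (i : n) : |v i| ≤ R := by
  have hsum := mem_orthogonal_ones_iff.1 hv
  have hn : (0 : ℝ) < Fintype.card n := Nat.cast_pos.2 (Fintype.card_pos_iff.2 ⟨i⟩)
  have hupper : Fintype.card n * v i ≤ Fintype.card n * R := by
    simpa [hsum] using Finset.sum_le_sum fun j (_ : j ∈ Finset.univ) => hR i j
  have hlower : -(Fintype.card n * v i) ≤ Fintype.card n * R := by
    simpa [hsum] using Finset.sum_le_sum fun j (_ : j ∈ Finset.univ) => hR j i
  exact abs_le.2 ⟨by nlinarith, by nlinarith⟩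

end Ones

section Loop

variable {α : Type*} {R : α → α → Prop} {P : α → Prop} {f : α → ℝ} {q : ℝ} {x₀ : α}

theorem exists_orbit_forall_exists_lt (hP : ∀ x, P x → ∃ y, R x y)
    (hR : ∀ x y, P x → R x y → P y ∧ f y ≤ q * f x) (hq₀ : 0 ≤ q) (hq : q < 1) (hx₀ : P x₀) :
    ∃ u : ℕ → α, u 0 = x₀ ∧ (∀ k, P (u k)) ∧ (∀ k, R (u k) (u (k + 1))) ∧
      ∀ η > 0, ∃ k, f (u k) < η := by
  choose g hg using hP
  let step : {x // P x} → {x // P x} := fun x => ⟨g x x.2, (hR _ _ x.2 (hg x x.2)).1⟩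
  let u : ℕ → {x // P x} := fun k => step^[k] ⟨x₀, hx₀⟩
  have hstep : ∀ k, R (u k) (u (k + 1)) := fun k => by
    simp only [u, Function.iterate_succ_apply']
    exact hg _ _
  have hgeom : ∀ k, f (u k) ≤ q ^ k * f x₀ := fun k => by
    induction k with
    | zero => simp [u]
    | succ k ih =>
      calc f (u (k + 1)) ≤ q * f (u k) := (hR _ _ (u k).2 (hstep k)).2
        _ ≤ q * (q ^ k * f x₀) := by gcongr
        _ = q ^ (k + 1) * f x₀ := by ring
  refine ⟨fun k => u k, rfl, fun k => (u k).2, hstep, fun η hη => ?_⟩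
  have hlim : Tendsto (fun k => q ^ k * f x₀) atTop (𝓝 0) := by
    simpa using (tendsto_pow_atTop_nhds_zero_of_lt_one hq₀ hq).mul_const (f x₀)
  obtain ⟨k, hk⟩ := (hlim.eventually_lt_const hη).exists
  exact ⟨k, (hgeom k).trans_lt hk⟩

theorem exists_terminating_run (hunique : Relator.RightUnique R) (hq₀ : 0 ≤ q) (hq : q < 1)
    (hP : ∀ x, P x → ∃ y, R x y) (hR : ∀ x y, P x → R x y → P y ∧ f y ≤ q * f x)
    (hx₀ : P x₀) {η : ℝ} (hη : 0 < η) :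
    ∃ T : ℕ,
      (∃ u : ℕ → α, (u 0 = x₀ ∧ ∀ k < T, η ≤ f (u k) ∧ R (u k) (u (k + 1))) ∧ f (u T) < η) ∧
      ∀ (n : ℕ) (w : ℕ → α), (w 0 = x₀ ∧ ∀ k < n, η ≤ f (w k) ∧ R (w k) (w (k + 1))) →
        n ≤ T ∧ ∀ k < n, f (w (k + 1)) ≤ q * f (w k) := by
  obtain ⟨u, hu₀, hPu, hRu, hlim⟩ := exists_orbit_forall_exists_lt hP hR hq₀ hq hx₀
  have hbelow := hlim η hη
  classical
  refine ⟨Nat.find hbelow, ⟨u, ⟨hu₀, fun k hk => ⟨not_lt.1 (Nat.find_min hbelow hk), hRu k⟩⟩,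
    Nat.find_spec hbelow⟩, fun n w ⟨hw₀, hw⟩ => ?_⟩
  have heq : ∀ k ≤ n, w k = u k := fun k => by
    induction k with
    | zero => exact fun _ => hw₀.trans hu₀.symm
    | succ k ih => exact fun hk => hunique (hw k hk).2 (ih (by omega) ▸ hRu k)
  refine ⟨?_, fun k hk => ?_⟩
  · by_contra! hlt
    exact absurd (Nat.find_spec hbelow) (not_lt.2 (heq _ hlt.le ▸ (hw _ hlt).1))
  · exact (hR _ _ (heq k hk.le ▸ hPu k) (hw k hk).2).2

end Loop

section MassLike

variable {n : Type*} [Fintype n]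

/-- The properties of the mass map on which the convergence of the damped Newton algorithm rests:
it is a `C¹` map into the affine hyperplane of total mass one, invariant under a common shift of
the weights, whose derivative degenerates only along such shifts as long as no mass vanishes, and
for which the differences of the weights are then bounded. -/
structure IsMassLike (G : EuclideanSpace ℝ n → EuclideanSpace ℝ n) : Prop where
  contDiff : ContDiff ℝ 1 G
  map_add_smul_ones : ∀ ψ (c : ℝ), G (ψ + c • ones n) = G ψ
  sum_eq_one : ∀ ψ, ∑ i, G ψ i = 1
  ker_fderiv_le : ∀ ψ, (∀ i, 0 < G ψ i) → (fderiv ℝ G ψ).ker ≤ ℝ ∙ ones n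
  exists_sub_le : ∃ R : ℝ, ∀ ψ, (∀ i, 0 < G ψ i) → ∀ i j, ψ i - ψ j ≤ R

namespace IsMassLike

variable {G : EuclideanSpace ℝ n → EuclideanSpace ℝ n} {ψ v ν : EuclideanSpace ℝ n}

theorem differentiable (h : IsMassLike G) : Differentiable ℝ G :=
  h.contDiff.differentiable one_ne_zero

theorem sub_mem (h : IsMassLike G) (hν : ∑ i, ν i = 1) (ψ : EuclideanSpace ℝ n) :
    G ψ - ν ∈ (ℝ ∙ ones n)ᗮ := by
  simp [mem_orthogonal_ones_iff, h.sum_eq_one, hν]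

theorem fderiv_add_smul_ones (h : IsMassLike G) (ψ : EuclideanSpace ℝ n) (c : ℝ) :
    fderiv ℝ G (ψ + c • ones n) = fderiv ℝ G ψ := by
  rw [← fderiv_comp_add_right]
  simp only [h.map_add_smul_ones]

theorem ones_mem_ker_fderiv (h : IsMassLike G) (ψ : EuclideanSpace ℝ n) :
    ones n ∈ (fderiv ℝ G ψ).ker := by
  have hline : HasDerivAt (fun c : ℝ => ψ + c • ones n) (ones n) 0 := by
    simpa using ((hasDerivAt_id (0 : ℝ)).smul_const (ones n)).const_add ψ
  have hcomp := (h.differentiable (ψ + (0 : ℝ) • ones n)).hasFDerivAt.comp_hasDerivAt 0 hline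
  have hconst : G ∘ (fun c : ℝ => ψ + c • ones n) = fun _ => G ψ :=
    funext fun c => h.map_add_smul_ones ψ c
  rw [hconst, h.fderiv_add_smul_ones] at hcomp
  exact hcomp.unique (hasDerivAt_const _ _)

theorem ker_fderiv (h : IsMassLike G) (hψ : ∀ i, 0 < G ψ i) :
    (fderiv ℝ G ψ).ker = ℝ ∙ ones n :=
  (h.ker_fderiv_le ψ hψ).antisymm <| by
    simpa [Submodule.span_le] using h.ones_mem_ker_fderiv ψ

theorem range_fderiv_le (h : IsMassLike G) (ψ : EuclideanSpace ℝ n) :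
    (fderiv ℝ G ψ).range ≤ (ℝ ∙ ones n)ᗮ := by
  rintro _ ⟨v, rfl⟩
  have hconst : (fun ψ => inner ℝ (ones n) (G ψ)) = fun _ => (1 : ℝ) := funext fun ψ => by
    simp [PiLp.inner_apply, h.sum_eq_one]
  have hderiv := (innerSL ℝ (ones n)).hasFDerivAt.comp ψ (h.differentiable ψ).hasFDerivAt
  have hzero := hderiv.unique (hconst ▸ hasFDerivAt_const (1 : ℝ) ψ)
  exact Submodule.mem_orthogonal_singleton_iff_inner_right.2 congr($hzero v)

theorem range_fderiv (h : IsMassLike G) (hψ : ∀ i, 0 < G ψ i) :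
    (fderiv ℝ G ψ).range = (ℝ ∙ ones n)ᗮ := by
  refine Submodule.eq_of_le_of_finrank_eq (h.range_fderiv_le ψ) ?_
  have hrank := (fderiv ℝ G ψ).toLinearMap.finrank_range_add_finrank_ker
  have hortho := (ℝ ∙ ones n).finrank_add_finrank_orthogonal
  rw [h.ker_fderiv hψ] at hrank
  omega

theorem isCompact_superlevel (h : IsMassLike G) {ε : ℝ} (hε : 0 < ε) :
    IsCompact {ψ | ψ ∈ (ℝ ∙ ones n)ᗮ ∧ ∀ i, ε ≤ G ψ i} := by
  have hG : Continuous G := h.contDiff.continuous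
  refine Metric.isCompact_of_isClosed_isBounded ?_ ?_
  · simp only [Set.ofPred_and, Set.ofPred_forall]
    exact (ℝ ∙ ones n)ᗮ.closed_of_finiteDimensional.inter <|
      isClosed_iInter fun i => isClosed_le continuous_const (by fun_prop)
  · obtain ⟨R, hR⟩ := h.exists_sub_le
    refine isBounded_iff_forall_norm_le.2 ⟨√(∑ _ : n, R ^ 2), fun ψ ⟨hψ, hGψ⟩ => ?_⟩
    rw [EuclideanSpace.norm_eq]
    gcongr with i
    exact abs_apply_le_of_mem_orthogonal_ones hψ (hR ψ fun i => hε.trans_le (hGψ i)) i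

theorem exists_norm_le_mul_norm_fderiv (h : IsMassLike G) {ε : ℝ} (hε : 0 < ε) :
    ∃ C > 0, ∀ ψ ∈ (ℝ ∙ ones n)ᗮ, (∀ i, ε ≤ G ψ i) → ∀ v ∈ (ℝ ∙ ones n)ᗮ,
      ‖v‖ ≤ C * ‖fderiv ℝ G ψ v‖ := by
  obtain ⟨C, hC, hle⟩ := exists_norm_le_mul_norm_apply (h.contDiff.continuous_fderiv one_ne_zero)
    (h.isCompact_superlevel hε) (ℝ ∙ ones n)ᗮ fun ψ hψ v hv hzero =>
      Submodule.disjoint_def.1 (ℝ ∙ ones n).orthogonal_disjoint v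
        (h.ker_fderiv_le ψ (fun i => hε.trans_le (hψ.2 i)) hzero) hv
  exact ⟨C, hC, fun ψ hψ hGψ => hle ψ ⟨hψ, hGψ⟩⟩

theorem norm_sub_le (h : IsMassLike G) (hψ : ∀ i, 0 ≤ G ψ i) (ν : EuclideanSpace ℝ n) :
    ‖G ψ - ν‖ ≤ 1 + ‖ν‖ :=
  (_root_.norm_sub_le _ _).trans <| by
    gcongr
    exact norm_le_one_of_nonneg_of_sum_eq_one hψ (h.sum_eq_one ψ)

theorem exists_newton_remainder_le (h : IsMassLike G) {ε ω : ℝ} (hε : 0 < ε) (hω : 0 < ω)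
    (ν : EuclideanSpace ℝ n) :
    ∃ t₀ > 0, ∀ ψ, (∀ i, ε ≤ G ψ i) → ∀ v ∈ (ℝ ∙ ones n)ᗮ, fderiv ℝ G ψ v = -(G ψ - ν) →
      ∀ t, 0 ≤ t → t ≤ t₀ → ‖G (ψ + t • v) - (G ψ - t • (G ψ - ν))‖ ≤ t * (ω * ‖G ψ - ν‖) := by
  obtain ⟨C, hC, hinv⟩ := h.exists_norm_le_mul_norm_fderiv hε
  obtain ⟨δ, hδ, happrox⟩ :=
    exists_norm_map_add_sub_le h.contDiff (h.isCompact_superlevel hε) (div_pos hω hC)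
  refine ⟨δ / (2 * (C * (1 + ‖ν‖))), by positivity, fun ψ' hψ' v hv hnewton t ht ht₀ => ?_⟩
  obtain ⟨_, hc, ψ, hψ, rfl⟩ := (ℝ ∙ ones n).exists_add_mem_mem_orthogonal ψ'
  obtain ⟨c, rfl⟩ := Submodule.mem_span_singleton.1 hc
  rw [add_comm (c • ones n)] at *
  rw [h.fderiv_add_smul_ones] at hnewton
  rw [add_right_comm]
  simp only [h.map_add_smul_ones] at hψ' hnewton ⊢
  have hv_le : ‖v‖ ≤ C * ‖G ψ - ν‖ := by
    simpa only [hnewton, norm_neg] using hinv ψ hψ hψ' v hv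
  have htv : ‖t • v‖ = t * ‖v‖ := by rw [norm_smul, Real.norm_of_nonneg ht]
  have hsmall : ‖t • v‖ < δ := by
    calc ‖t • v‖ ≤ δ / (2 * (C * (1 + ‖ν‖))) * (C * (1 + ‖ν‖)) := by
          rw [htv]
          gcongr
          exact hv_le.trans (by gcongr; exact h.norm_sub_le (fun i => hε.le.trans (hψ' i)) ν)
      _ = δ / 2 := by field_simp
      _ < δ := half_lt_self hδ
  calc ‖G (ψ + t • v) - (G ψ - t • (G ψ - ν))‖
      = ‖G (ψ + t • v) - G ψ - fderiv ℝ G ψ (t • v)‖ := by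
        rw [map_smul, hnewton, smul_neg]
        congr 1
        abel
    _ ≤ ω / C * (t * ‖v‖) := htv ▸ happrox ψ ⟨hψ, hψ'⟩ _ hsmall
    _ ≤ ω / C * (t * (C * ‖G ψ - ν‖)) := by gcongr
    _ = t * (ω * ‖G ψ - ν‖) := by field_simp

theorem exists_stepSize (h : IsMassLike G) {ε : ℝ} (hε : 0 < ε) (hν : ∀ i, 2 * ε ≤ ν i) :
    ∃ t₀ > 0, ∀ ψ, (∀ i, ε ≤ G ψ i) → ∀ v ∈ (ℝ ∙ ones n)ᗮ, fderiv ℝ G ψ v = -(G ψ - ν) →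
      ∀ t, 0 ≤ t → t ≤ 1 → t ≤ t₀ →
        (∀ i, ε ≤ G (ψ + t • v) i) ∧ ‖G (ψ + t • v) - ν‖ ≤ (1 - t / 2) * ‖G ψ - ν‖ := by
  set R := 1 + ‖ν‖
  obtain ⟨t₀, ht₀, hrem⟩ := h.exists_newton_remainder_le hε
    (show 0 < min (1 / 2) (ε / R) by positivity) ν
  refine ⟨t₀, ht₀, fun ψ hψ v hv hnewton t ht ht₁ htt₀ => ?_⟩
  have hr := hrem ψ hψ v hv hnewton t ht htt₀
  have hR : ‖G ψ - ν‖ ≤ R := h.norm_sub_le (fun i => hε.le.trans (hψ i)) ν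
  refine ⟨fun i => le_apply_of_norm_sub_damped_le ht ht₁ (hr.trans ?_) (hψ i) (hν i),
    norm_sub_le_of_norm_sub_damped_le ht₁ (hr.trans ?_)⟩
  · gcongr
    calc min (1 / 2) (ε / R) * ‖G ψ - ν‖ ≤ ε / R * R := by
          gcongr
          exact min_le_right _ _
      _ = ε := div_mul_cancel₀ _ (by positivity)
  · calc t * (min (1 / 2) (ε / R) * ‖G ψ - ν‖) ≤ t * (1 / 2 * ‖G ψ - ν‖) := by
          gcongr
          exact min_le_left _ _
      _ = t / 2 * ‖G ψ - ν‖ := by ring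

section

variable {N : ℕ} {G : EuclideanSpace ℝ (Fin N) → EuclideanSpace ℝ (Fin N)}
  {ν : EuclideanSpace ℝ (Fin N)} {ε₀ : ℝ}

theorem mem_orthogonal_ones_and_fderiv_apply (h : IsMassLike G) {ψ v : EuclideanSpace ℝ (Fin N)}
    (hψ : ∀ i, 0 < G ψ i) (hν : ∑ i, ν i = 1) (hv : IsNewtonDirection G ν ψ v) :
    v ∈ (ℝ ∙ ones (Fin N))ᗮ ∧ fderiv ℝ G ψ v = -(G ψ - ν) :=
  ⟨h.ker_fderiv hψ ▸ hv.mem_orthogonal_ker,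
    hv.fderiv_apply (h.range_fderiv hψ ▸ h.sub_mem hν ψ)⟩

theorem exists_forall_mem_admissibleExponents (h : IsMassLike G) (hν : ∑ i, ν i = 1)
    (hε : 0 < ε₀) (hν₂ : ∀ i, 2 * ε₀ ≤ ν i) :
    ∃ L, ∀ ψ v, (∀ i, ε₀ ≤ G ψ i) → IsNewtonDirection G ν ψ v →
      L ∈ admissibleExponents G ν ε₀ ψ v := by
  obtain ⟨t₀, ht₀, hstep⟩ := h.exists_stepSize hε hν₂
  obtain ⟨L, hL⟩ := exists_pow_lt_of_lt_one ht₀ (by norm_num : (2⁻¹ : ℝ) < 1)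
  refine ⟨L, fun ψ v hψ hv => ?_⟩
  obtain ⟨hv_mem, hnewton⟩ :=
    h.mem_orthogonal_ones_and_fderiv_apply (fun i => hε.trans_le (hψ i)) hν hv
  obtain ⟨hmass, hnorm⟩ := hstep ψ hψ v hv_mem hnewton _ (by positivity)
    (pow_le_one₀ (by norm_num) (by norm_num)) hL.le
  exact ⟨hmass, hnorm.trans_eq (by rw [pow_succ, div_eq_mul_inv])⟩

theorem exists_contraction_rate (h : IsMassLike G) (hν : ∑ i, ν i = 1) (hε : 0 < ε₀)
    (hν₂ : ∀ i, 2 * ε₀ ≤ ν i) :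
    ∃ τ : ℝ, 0 < τ ∧ τ ≤ 1 ∧ ∀ ψ, (∀ i, ε₀ ≤ G ψ i) →
      (∃ φ, IsDampedNewtonStep G ν ε₀ ψ φ) ∧
      ∀ φ, IsDampedNewtonStep G ν ε₀ ψ φ →
        (∀ i, ε₀ ≤ G φ i) ∧ ‖G φ - ν‖ ≤ (1 - τ / 2) * ‖G ψ - ν‖ := by
  obtain ⟨L, hL⟩ := h.exists_forall_mem_admissibleExponents hν hε hν₂
  refine ⟨2⁻¹ ^ L, by positivity, pow_le_one₀ (by norm_num) (by norm_num), fun ψ hψ => ⟨?_, ?_⟩⟩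
  · obtain ⟨v, hv⟩ := exists_isNewtonDirection (h.differentiable ψ) ν
    exact exists_isDampedNewtonStep hv ⟨L, hL ψ v hψ hv⟩
  · rintro φ ⟨v, l, hv, ⟨hl, hleast⟩, rfl⟩
    refine ⟨hl.1, hl.2.trans ?_⟩
    have hpow : (2⁻¹ : ℝ) ^ L ≤ 2⁻¹ ^ l :=
      pow_le_pow_of_le_one (by norm_num) (by norm_num) (hleast (hL ψ v hψ hv))
    rw [pow_succ, ← div_eq_mul_inv]
    gcongr

theorem exists_dampedNewton_converges (h : IsMassLike G) (hν : ∑ i, ν i = 1) (hε : 0 < ε₀)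
    (hν₂ : ∀ i, 2 * ε₀ ≤ ν i) :
    ∃ τ : ℝ, 0 < τ ∧ τ ≤ 1 ∧
      ∀ ψ₀ : EuclideanSpace ℝ (Fin N), (∀ i, ε₀ ≤ G ψ₀ i) → ∀ η : ℝ, 0 < η →
        ∃ T : ℕ,
          (∃ ψ : ℕ → EuclideanSpace ℝ (Fin N),
            IsDampedNewtonRun G ν ε₀ η ψ₀ T ψ ∧ ‖G (ψ T) - ν‖ < η) ∧
          ∀ (n : ℕ) (ψ : ℕ → EuclideanSpace ℝ (Fin N)),
            IsDampedNewtonRun G ν ε₀ η ψ₀ n ψ →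
            n ≤ T ∧ ∀ k < n, ‖G (ψ (k + 1)) - ν‖ ≤ (1 - τ / 2) * ‖G (ψ k) - ν‖ := by
  obtain ⟨τ, hτ, hτ1, hrate⟩ := h.exists_contraction_rate hν hε hν₂
  refine ⟨τ, hτ, hτ1, fun ψ₀ hψ₀ η hη => ?_⟩
  exact exists_terminating_run (R := IsDampedNewtonStep G ν ε₀) (P := fun ψ => ∀ i, ε₀ ≤ G ψ i)
    (f := fun ψ => ‖G ψ - ν‖) (q := 1 - τ / 2)
    (fun _ _ _ => IsDampedNewtonStep.unique) (by linarith) (by linarith)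
    (fun ψ hψ => (hrate ψ hψ).1) (fun ψ φ hψ => (hrate ψ hψ).2 φ) hψ₀ hη

end

end IsMassLike

end MassLike

section PartialDerivatives

variable {ι : Type*} [DecidableEq ι]

theorem hasFDerivAt_comp_piecewise [Finite ι] {F : (ι → ℝ) → ℝ} {g : ι → (ι → ℝ) → ℝ}
    (hg : ∀ i, Continuous (g i))
    (hF : ∀ i c, HasDerivAt (fun t => F (Function.update c i t)) (g i c) (c i)) (s : Finset ι)
    (c x : ι → ℝ) :
    HasFDerivAt (fun x => F (s.piecewise x c))
      (∑ i ∈ s, g i (s.piecewise x c) • (ContinuousLinearMap.proj i : (ι → ℝ) →L[ℝ] ℝ)) x := by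
  cases nonempty_fintype ι
  induction s using Finset.induction_on generalizing c x with
  | empty => simpa using hasFDerivAt_const (F c) x
  | insert a s ha ih =>
    let p : (ι → ℝ) → ℝ → ι → ℝ := fun x t => s.piecewise x (Function.update c a t)
    have hp : Continuous fun q : (ι → ℝ) × ℝ => p q.1 q.2 := continuous_pi fun i => by
      by_cases hi : i ∈ s
      · simpa [p, hi] using by fun_prop
      · simpa [p, hi] using by fun_prop
    have p_eq_update : ∀ x t, p x t = Function.update (s.piecewise x c) a t := fun x t =>
      (Finset.update_piecewise_of_notMem s x c ha t).symm
    have hpartial : ∀ x t, HasFDerivAt (fun t => F (p x t))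
        (ContinuousLinearMap.toSpanSingleton ℝ (g a (p x t))) t := fun x t => by
      simpa [p_eq_update] using (hF a (p x t)).hasFDerivAt
    have hf := hasStrictFDerivAt_uncurry_coprod (u := (x, x a)) (f := fun x t => F (p x t))
      (f₁ := fun x t => ∑ i ∈ s, g i (p x t) • ContinuousLinearMap.proj i)
      (f₂ := fun x t => ContinuousLinearMap.toSpanSingleton ℝ (g a (p x t)))
      (Eventually.of_forall fun q => ih (Function.update c a q.2) q.1)
      (Eventually.of_forall fun q => hpartial q.1 q.2)
      (continuous_finsetSum _ fun i _ => ((hg i).comp hp).smul continuous_const).continuousAt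
      ((ContinuousLinearMap.toSpanSingletonCLE (𝕜 := ℝ) (E := ℝ)).continuous.comp
        ((hg a).comp hp)).continuousAt
    have hdiag := hf.hasFDerivAt.comp x
      ((hasFDerivAt_id x).prodMk (ContinuousLinearMap.proj (R := ℝ) a).hasFDerivAt)
    simp only [Finset.piecewise_insert, ← p_eq_update, Finset.sum_insert ha]
    refine hdiag.congr_fderiv ?_
    ext
    simp [Function.HasUncurry.uncurry, add_comm, mul_comm]

theorem hasFDerivAt_of_continuous_partials [Fintype ι] {F : (ι → ℝ) → ℝ}
    {g : ι → (ι → ℝ) → ℝ} (hg : ∀ i, Continuous (g i))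
    (hF : ∀ i c, HasDerivAt (fun t => F (Function.update c i t)) (g i c) (c i)) (c : ι → ℝ) :
    HasFDerivAt F (∑ i, g i c • (ContinuousLinearMap.proj i : (ι → ℝ) →L[ℝ] ℝ)) c := by
  simpa using hasFDerivAt_comp_piecewise hg hF Finset.univ c c

end PartialDerivatives

section CutIntegral

theorem continuousAt_setIntegral_of_dominated {X W κ : Type*} [TopologicalSpace X]
    [FirstCountableTopology X] [MeasurableSpace W] [Finite κ] {ν : Measure W} {F : X → W → ℝ}
    {h : κ → X → W → ℝ} {b : W → ℝ} {x₀ : X} (hF_meas : ∀ x, AEStronglyMeasurable (F x) ν)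
    (hFb : ∀ x w, ‖F x w‖ ≤ b w) (hb : Integrable b ν) (hFc : ∀ w, ContinuousAt (F · w) x₀)
    (hh_meas : ∀ m x, Measurable (h m x)) (hh : ∀ m w, ContinuousAt (h m · w) x₀)
    (hne : ∀ᵐ w ∂ν, ∀ m, h m x₀ w ≠ 0) :
    ContinuousAt (fun x => ∫ w in {w | ∀ m, h m x w ≤ 0}, F x w ∂ν) x₀ := by
  have hmeas : ∀ x, MeasurableSet {w | ∀ m, h m x w ≤ 0} := fun x => by
    simp only [ofPred_forall]
    exact .iInter fun m => measurableSet_le (hh_meas m x) measurable_const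
  simp_rw [← integral_indicator (hmeas _)]
  refine continuousAt_of_dominated (bound := b)
    (Eventually.of_forall fun x => (hF_meas x).indicator (hmeas x))
    (Eventually.of_forall fun x => Eventually.of_forall fun w =>
      (norm_indicator_le_norm_self _ _).trans (hFb x w)) hb ?_
  filter_upwards [hne] with w hw
  by_cases hin : ∀ m, h m x₀ w < 0
  · refine (hFc w).congr ?_
    filter_upwards [eventually_all.2 fun m => (hh m w).eventually_lt_const (hin m)] with x hx
    exact (indicator_of_mem (s := {w | ∀ m, h m x w ≤ 0}) (fun m => (hx m).le) _).symm
  · push Not at hin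
    obtain ⟨m, hm⟩ := hin
    refine continuousAt_const.congr (f := fun _ => 0) ?_
    filter_upwards [(hh m w).eventually_const_lt (hm.lt_of_ne' (hw m))] with x hx
    exact (indicator_of_notMem (s := {w | ∀ m, h m x w ≤ 0}) (fun h => (h m).not_gt hx) _).symm

theorem ae_apply_ne {E : Type*} [NormedAddCommGroup E] [NormedSpace ℝ E]
    [FiniteDimensional ℝ E] [MeasurableSpace E] [BorelSpace E] (μ : Measure E)
    [μ.IsAddHaarMeasure] {l : E →L[ℝ] ℝ} (hl : l ≠ 0) (a : ℝ) : ∀ᵐ x ∂μ, l x ≠ a := by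
  obtain ⟨e, he⟩ := ContinuousLinearMap.exists_ne_zero hl
  let H : AffineSubspace ℝ E := (AffineSubspace.mk' a ⊥).comap l.toLinearMap.toAffineMap
  have mem_H : ∀ x, x ∈ H ↔ l x = a := fun x => by
    simp [H, AffineSubspace.mem_mk', sub_eq_zero]
  have hH : H ≠ ⊤ := fun h => he <| by
    have h₀ := (mem_H 0).1 (h ▸ AffineSubspace.mem_top ℝ E 0)
    have h₁ := (mem_H e).1 (h ▸ AffineSubspace.mem_top ℝ E e)
    rw [h₁, ← h₀, map_zero]
  filter_upwards [measure_eq_zero_iff_ae_notMem.1 (Measure.addHaar_affineSubspace μ H hH)]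
    with x hx using fun h => hx ((mem_H x).2 h)

/-- The polyhedron cut out by the inequalities `l m x ≤ c m`. -/
def polyhedron {E κ : Type*} [AddCommGroup E] [Module ℝ E] [TopologicalSpace E]
    (l : κ → E →L[ℝ] ℝ) (c : κ → ℝ) : Set E :=
  {x | ∀ m, l m x ≤ c m}

theorem isClosed_polyhedron {E κ : Type*} [AddCommGroup E] [Module ℝ E] [TopologicalSpace E]
    (l : κ → E →L[ℝ] ℝ) (c : κ → ℝ) : IsClosed (polyhedron l c) := by
  simp only [polyhedron, ofPred_forall]
  exact isClosed_iInter fun m => isClosed_le (l m).continuous continuous_const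

/-- The relative interior of the facet `l j x = c j` of a polyhedron. -/
def openFacet {E κ : Type*} [AddCommGroup E] [Module ℝ E] [TopologicalSpace E]
    (l : κ → E →L[ℝ] ℝ) (c : κ → ℝ) (j : κ) : Set E :=
  {x | l j x = c j ∧ ∀ m, m ≠ j → l m x < c m}

theorem openFacet_subset_polyhedron {E κ : Type*} [AddCommGroup E] [Module ℝ E]
    [TopologicalSpace E] (l : κ → E →L[ℝ] ℝ) (c : κ → ℝ) (j : κ) :
    openFacet l c j ⊆ polyhedron l c := fun x hx m => by
  by_cases h : m = j
  · exact h ▸ hx.1.le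
  · exact (hx.2 m h).le

theorem openFacet_nonempty_of_direction {E κ : Type*} [AddCommGroup E] [Module ℝ E]
    [TopologicalSpace E] [Finite κ] {l : κ → E →L[ℝ] ℝ} {c : κ → ℝ} {j : κ} {x u : E}
    (hx : x ∈ polyhedron l c) (hxj : l j x = c j) (huj : l j u = 0)
    (hu : ∀ m, m ≠ j → l m x = c m → l m u < 0) : (openFacet l c j).Nonempty := by
  have hev : ∀ᶠ e in 𝓝[>] (0 : ℝ), ∀ m, m ≠ j → l m (x + e • u) < c m := by
    refine eventually_all.2 fun m => ?_
    simp only [map_add, map_smul, smul_eq_mul]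
    rcases (hx m).lt_or_eq with hlt | heq
    · have hcont : Continuous fun e : ℝ => l m x + e * l m u := by fun_prop
      filter_upwards [((hcont.tendsto' 0 _ (by simp)).eventually_lt_const hlt).filter_mono
        nhdsWithin_le_nhds] with e he _ using he
    · filter_upwards [self_mem_nhdsWithin] with e he hm
      rw [heq]
      linarith [mul_neg_of_pos_of_neg he (hu m hm heq)]
  obtain ⟨e, he⟩ := hev.exists
  exact ⟨x + e • u, by simp [hxj, huj], he⟩

/-- The integral of `f` over a polyhedron, as a function of the offsets `c`. -/
noncomputable def cutIntegral {E κ : Type*} [AddCommGroup E] [Module ℝ E] [TopologicalSpace E]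
    [MeasurableSpace E] (μ : Measure E) (f : E → ℝ) (l : κ → E →L[ℝ] ℝ) (c : κ → ℝ) : ℝ :=
  ∫ x in polyhedron l c, f x ∂μ

section Slice

variable {W κ : Type*} [NormedAddCommGroup W] [NormedSpace ℝ W] [MeasurableSpace W]

/-- The integral of `f` over the slice at height `s` of the polyhedron in `ℝ × W` cut out by the
inequalities other than the `j`-th one. It is used when the `j`-th functional is the height, so
that it is the density of the rate at which the polyhedron grows with the offset `c j`. -/
noncomputable def sliceIntegral (ν : Measure W) (f : ℝ × W → ℝ) (l : κ → ℝ × W →L[ℝ] ℝ) (j : κ)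
    (c : κ → ℝ) (s : ℝ) : ℝ :=
  ∫ w in {w | ∀ m : {m // m ≠ j}, l m (s, w) - c m ≤ 0}, f (s, w) ∂ν

variable {ν : Measure W} {f : ℝ × W → ℝ} {l : κ → ℝ × W →L[ℝ] ℝ} {j : κ}

theorem sliceIntegral_nonneg (hf₀ : ∀ x, 0 ≤ f x) (c : κ → ℝ) (s : ℝ) :
    0 ≤ sliceIntegral ν f l j c s :=
  integral_nonneg fun _ => hf₀ _

theorem sliceIntegral_update [DecidableEq κ] (c : κ → ℝ) (t : ℝ) :
    sliceIntegral ν f l j (Function.update c j t) = sliceIntegral ν f l j c := by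
  funext s
  have h : ∀ m : {m // m ≠ j}, Function.update c j t m = c m := fun m =>
    Function.update_of_ne m.2 _ _
  simp only [sliceIntegral, h]

theorem hasCompactSupport_sliceIntegral (hfc : HasCompactSupport f) (c : κ → ℝ) :
    HasCompactSupport (sliceIntegral ν f l j c) := by
  refine HasCompactSupport.intro (hfc.isCompact.image continuous_fst) fun s hs => ?_
  have hzero : ∀ w, f (s, w) = 0 := fun w => by
    by_contra h
    exact hs ⟨(s, w), subset_tsupport _ h, rfl⟩
  simp [sliceIntegral, hzero]

variable [BorelSpace W]

theorem sliceIntegral_pos [Finite κ] [ν.IsAddHaarMeasure] (hf : Continuous f)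
    (hfc : HasCompactSupport f) (hf₀ : ∀ x, 0 ≤ f x) {c : κ → ℝ} {s : ℝ} {w : W}
    (hw : ∀ m, m ≠ j → l m (s, w) < c m) (hfw : 0 < f (s, w)) :
    0 < sliceIntegral ν f l j c s := by
  have hfs : HasCompactSupport fun w => f (s, w) :=
    .intro (hfc.isCompact.image continuous_snd) fun w hw => by
      by_contra h
      exact hw ⟨(s, w), subset_tsupport _ h, rfl⟩
  have hint : Integrable (fun w => f (s, w)) ν :=
    (by fun_prop : Continuous fun w => f (s, w)).integrable_of_hasCompactSupport hfs
  rw [sliceIntegral, setIntegral_pos_iff_support_of_nonneg_ae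
    (Eventually.of_forall fun w => hf₀ _) hint.integrableOn]
  have hopen : IsOpen ({w | 0 < f (s, w)} ∩ ⋂ m : {m // m ≠ j}, {w | l m (s, w) - c m < 0}) :=
    (isOpen_lt continuous_const (by fun_prop)).inter
      (isOpen_iInter_of_finite fun m => isOpen_lt (by fun_prop) continuous_const)
  refine (hopen.measure_pos ν ⟨w, hfw, ?_⟩).trans_le (measure_mono fun v hv => ?_)
  · exact mem_iInter.2 fun m => sub_neg.2 (hw m m.2)
  · exact ⟨ne_of_gt hv.1, fun m => le_of_lt (mem_iInter.1 hv.2 m)⟩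

variable [FiniteDimensional ℝ W]

theorem cutIntegral_prod [ν.IsAddHaarMeasure] (hf : Continuous f) (hfc : HasCompactSupport f)
    (hj : ∀ q, l j q = q.1) (c : κ → ℝ) :
    cutIntegral (volume.prod ν) f l c = ∫ s in Iic (c j), sliceIntegral ν f l j c s := by
  have hmeas := (isClosed_polyhedron l c).measurableSet
  have mem_polyhedron : ∀ s w, (s, w) ∈ polyhedron l c ↔
      s ∈ Iic (c j) ∧ w ∈ {w | ∀ m : {m // m ≠ j}, l m (s, w) - c m ≤ 0} := fun s w => by
    simp only [polyhedron, mem_ofPred_eq, mem_Iic, sub_nonpos, Subtype.forall]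
    refine ⟨fun h => ⟨(hj (s, w)).symm.trans_le (h j), fun m _ => h m⟩, fun h m => ?_⟩
    rcases eq_or_ne m j with rfl | hm
    · exact (hj (s, w)).trans_le h.1
    · exact h.2 m hm
  have hint := hf.integrable_of_hasCompactSupport hfc (μ := (volume : Measure ℝ).prod ν)
  rw [cutIntegral, ← integral_indicator hmeas, integral_prod _ (hint.indicator hmeas),
    ← integral_indicator measurableSet_Iic]
  congr with s
  have hslice : MeasurableSet {w | ∀ m : {m // m ≠ j}, l m (s, w) - c m ≤ 0} := by
    simp only [ofPred_forall]
    exact (isClosed_iInter fun m => isClosed_le (by fun_prop) continuous_const).measurableSet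
  by_cases hs : s ∈ Iic (c j)
  · rw [indicator_of_mem hs, sliceIntegral, ← integral_indicator hslice]
    refine integral_congr_ae (Eventually.of_forall fun w => ?_)
    classical simp only [indicator_apply, mem_polyhedron, hs, true_and]
  · rw [indicator_of_notMem hs]
    simp [indicator, mem_polyhedron, hs]

theorem continuous_sliceIntegral [Finite κ] [ν.IsAddHaarMeasure] (hf : Continuous f)
    (hfc : HasCompactSupport f) (hl : ∀ m, m ≠ j → ∃ w, l m (0, w) ≠ 0) :
    Continuous fun q : (κ → ℝ) × ℝ => sliceIntegral ν f l j q.1 q.2 := by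
  obtain ⟨C, hC⟩ := hf.bounded_above_of_compact_support hfc
  have hQ : IsCompact (Prod.snd '' tsupport f) := hfc.isCompact.image continuous_snd
  have hbound : ∀ s w, ‖f (s, w)‖ ≤ (Prod.snd '' tsupport f).indicator (fun _ => C) w :=
    fun s w => by
      by_cases hw : w ∈ Prod.snd '' tsupport f
      · simpa only [indicator_of_mem hw] using hC _
      · have hzero : f (s, w) = 0 := by
          by_contra h
          exact hw ⟨(s, w), subset_tsupport _ h, rfl⟩
        simp [hzero, hw]
  refine continuous_iff_continuousAt.2 fun q₀ => continuousAt_setIntegral_of_dominated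
    (h := fun (m : {m // m ≠ j}) (q : (κ → ℝ) × ℝ) w => l m (q.2, w) - q.1 m)
    (fun q => (by fun_prop : Continuous fun w => f (q.2, w)).aestronglyMeasurable)
    (fun q w => hbound q.2 w)
    ((integrable_indicator_iff hQ.measurableSet).2 (integrableOn_const hQ.measure_lt_top.ne))
    (fun w => by fun_prop) (fun m q => by fun_prop) (fun m w => by fun_prop)
    (ae_all_iff.2 fun m => ?_)
  have hm : (l m).comp (.inr ℝ ℝ W) ≠ 0 := fun h => by
    obtain ⟨w, hw⟩ := hl m m.2
    exact hw (by simpa using congr($h w))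
  filter_upwards [ae_apply_ne ν hm (q₀.1 m - l m (q₀.2, 0))] with w hw h
  have hadd : l m (q₀.2, w) = l m (q₀.2, 0) + l m (0, w) := by simp [← map_add]
  exact hw (by simp; linarith)

theorem hasDerivAt_cutIntegral_prod [Finite κ] [DecidableEq κ] [ν.IsAddHaarMeasure]
    (hf : Continuous f) (hfc : HasCompactSupport f) (hj : ∀ q, l j q = q.1)
    (hl : ∀ m, m ≠ j → ∃ w, l m (0, w) ≠ 0) (c : κ → ℝ) :
    HasDerivAt (fun t => cutIntegral (volume.prod ν) f l (Function.update c j t))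
      (sliceIntegral ν f l j c (c j)) (c j) := by
  simp only [cutIntegral_prod hf hfc hj, Function.update_self, sliceIntegral_update]
  have hcont : Continuous (sliceIntegral ν f l j c) :=
    (continuous_sliceIntegral hf hfc hl).comp (by fun_prop : Continuous fun s => (c, s))
  have hint : Integrable (sliceIntegral ν f l j c) :=
    hcont.integrable_of_hasCompactSupport (hasCompactSupport_sliceIntegral hfc c)
  have hsplit : ∀ t, ∫ s in Iic t, sliceIntegral ν f l j c s =
      (∫ s in Iic (c j), sliceIntegral ν f l j c s) + ∫ s in (c j)..t, sliceIntegral ν f l j c s :=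
    fun t => by
      rw [← intervalIntegral.integral_Iic_sub_Iic hint.integrableOn hint.integrableOn,
        add_sub_cancel]
  rw [funext hsplit]
  exact (intervalIntegral.integral_hasDerivAt_right (hcont.intervalIntegrable _ _)
    hcont.stronglyMeasurable.stronglyMeasurableAtFilter hcont.continuousAt).const_add _

end Slice

theorem exists_pos_cutIntegral_eq {E F κ : Type*} [NormedAddCommGroup E] [NormedSpace ℝ E]
    [MeasurableSpace E] [BorelSpace E] [NormedAddCommGroup F] [NormedSpace ℝ F]
    [FiniteDimensional ℝ F] [MeasurableSpace F] [BorelSpace F] (μ : Measure E)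
    [μ.IsAddHaarMeasure] (ν : Measure F) [ν.IsAddHaarMeasure] (T : F ≃L[ℝ] E) :
    ∃ C : ℝ, 0 < C ∧ ∀ (f : E → ℝ) (l : κ → E →L[ℝ] ℝ) (c : κ → ℝ),
      cutIntegral μ f l c = C * cutIntegral ν (f ∘ T) (fun m => (l m).comp (T : F →L[ℝ] E)) c := by
  have : (μ.map T.symm).IsAddHaarMeasure := T.symm.isAddHaarMeasure_map μ
  refine ⟨(μ.map T.symm).addHaarScalarFactor ν, ?_, fun f l c => ?_⟩
  · exact_mod_cast Measure.addHaarScalarFactor_pos_of_isAddHaarMeasure _ ν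
  · have hT : MeasurableEmbedding T := T.toHomeomorph.measurableEmbedding
    have hmap : (μ.map T.symm).map T = μ := by
      rw [Measure.map_map hT.measurable (by fun_prop)]
      simp
    calc cutIntegral μ f l c
        = ∫ x in polyhedron l c, f x ∂(μ.map T.symm).map T := by rw [hmap, cutIntegral]
      _ = ∫ q in T ⁻¹' polyhedron l c, f (T q) ∂(μ.map T.symm) := hT.setIntegral_map _ _
      _ = _ := by
        conv_lhs => rw [Measure.isAddLeftInvariant_eq_smul (μ.map T.symm) ν]
        rw [Measure.restrict_smul, integral_smul_nnreal_measure]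
        rfl

theorem exists_hasDerivAt_cutIntegral {E κ : Type*} [NormedAddCommGroup E] [NormedSpace ℝ E]
    [FiniteDimensional ℝ E] [MeasurableSpace E] [BorelSpace E] [Finite κ] [DecidableEq κ]
    (μ : Measure E) [μ.IsAddHaarMeasure] {f : E → ℝ} (hf : Continuous f)
    (hfc : HasCompactSupport f) (hf₀ : ∀ x, 0 ≤ f x) (l : κ → E →L[ℝ] ℝ) (j : κ) (hj : l j ≠ 0)
    (hl : ∀ m, m ≠ j → ∃ w, l j w = 0 ∧ l m w ≠ 0) :
    ∃ g : (κ → ℝ) → ℝ, Continuous g ∧ (∀ c, 0 ≤ g c) ∧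
      (∀ c, HasDerivAt (fun t => cutIntegral μ f l (Function.update c j t)) (g c) (c j)) ∧
      ∀ c, ∀ x ∈ openFacet l c j, 0 < f x → 0 < g c := by
  obtain ⟨e, he⟩ : ∃ e, l j e = 1 := by
    obtain ⟨e, he⟩ := ContinuousLinearMap.exists_ne_zero hj
    exact ⟨(l j e)⁻¹ • e, by simp [he]⟩
  obtain ⟨T, T_apply⟩ : ∃ T : (ℝ × (l j).ker) ≃L[ℝ] E, ∀ q, T q = q.1 • e + (q.2 : E) :=
    ⟨(ContinuousLinearEquiv.equivOfRightInverse (l j)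
      (ContinuousLinearMap.toSpanSingleton ℝ e) fun s => by simp [he]).symm, fun _ => rfl⟩
  let lT : κ → (ℝ × (l j).ker) →L[ℝ] ℝ := fun m => (l m).comp (T : (ℝ × (l j).ker) →L[ℝ] E)
  have hjT : ∀ q, lT j q = q.1 := fun q => by
    have : l j (q.2 : E) = 0 := q.2.2
    simp [lT, T_apply, he, this]
  have hlT : ∀ m, m ≠ j → ∃ w, lT m (0, w) ≠ 0 := fun m hm => by
    obtain ⟨w, hjw, hmw⟩ := hl m hm
    exact ⟨⟨w, hjw⟩, by simpa [lT, T_apply] using hmw⟩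
  let ν : Measure (l j).ker := Measure.addHaar
  have hfT : HasCompactSupport (f ∘ T) := hfc.comp_homeomorph T.toHomeomorph
  have hfT' : Continuous (f ∘ T) := hf.comp T.continuous
  obtain ⟨C, hC, hμ⟩ :=
    exists_pos_cutIntegral_eq (κ := κ) μ ((volume : Measure ℝ).prod ν) T
  refine ⟨fun c => C * sliceIntegral ν (f ∘ T) lT j c (c j), ?_,
    fun c => mul_nonneg hC.le (sliceIntegral_nonneg (fun _ => hf₀ _) _ _), fun c => ?_,
    fun c x ⟨hjx, hmx⟩ hfx => mul_pos hC ?_⟩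
  · exact continuous_const.mul ((continuous_sliceIntegral hfT' hfT hlT).comp
      (by fun_prop : Continuous fun c : κ → ℝ => (c, c j)))
  · simp only [hμ f l]
    exact (hasDerivAt_cutIntegral_prod hfT' hfT hjT hlT c).const_mul C
  · obtain ⟨⟨s, w⟩, rfl⟩ := T.surjective x
    obtain rfl : s = c j := (hjT (s, w)).symm.trans hjx
    exact sliceIntegral_pos hfT' hfT (fun _ => hf₀ _) hmx hfx

end CutIntegral

section Chart

variable {E : Type*} [NormedAddCommGroup E] [InnerProductSpace ℝ E] {k : ℕ}
  (σ : Affine.Simplex ℝ E k)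

/-- The vector space parallel to a simplex. -/
abbrev directionSpace : Submodule ℝ E := vectorSpan ℝ (range σ.points)

/-- The isometric parametrization of the affine span of a simplex by the parallel vector space,
which sends the origin to the vertex `σ.points 0`. -/
noncomputable def chart : directionSpace σ →ᵃⁱ[ℝ] E :=
  (AffineIsometryEquiv.vaddConst ℝ (σ.points 0)).toAffineIsometry.comp
    (directionSpace σ).subtypeₗᵢ.toAffineIsometry

variable {σ}

theorem chart_apply (w : directionSpace σ) : chart σ w = w + σ.points 0 := rfl

theorem mem_range_chart_of_mem_affineSpan {x : E} (hx : x ∈ affineSpan ℝ (range σ.points)) :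
    x ∈ range (chart σ) :=
  ⟨⟨x - σ.points 0, vsub_mem_vectorSpan_of_mem_affineSpan_of_mem_affineSpan hx
    (mem_affineSpan ℝ (mem_range_self 0))⟩, by simp [chart_apply]⟩

variable (σ)

/-- The vertices of a simplex, in the coordinates of `chart σ`; the associated coordinates are the
barycentric coordinates. -/
noncomputable def vertexBasis : AffineBasis (Fin (k + 1)) ℝ (directionSpace σ) :=
  have hind : AffineIndependent ℝ fun m => (⟨σ.points m - σ.points 0,
      vsub_mem_vectorSpan ℝ (mem_range_self m) (mem_range_self 0)⟩ : directionSpace σ) :=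
    AffineIndependent.of_comp (chart σ).toAffineMap <| by
      convert! σ.independent
      exact sub_add_cancel _ _
  ⟨_, hind, hind.affineSpan_eq_top_iff_card_eq_finrank_add_one.2 <| by
    rw [σ.independent.finrank_vectorSpan (Fintype.card_fin _), Fintype.card_fin]⟩

variable {σ}

theorem chart_vertexBasis (m : Fin (k + 1)) : chart σ (vertexBasis σ m) = σ.points m :=
  sub_add_cancel _ _

theorem chart_comp_vertexBasis : chart σ ∘ vertexBasis σ = σ.points :=
  funext chart_vertexBasis

theorem preimage_chart_convexHull :
    chart σ ⁻¹' convexHull ℝ (range σ.points) = {w | ∀ m, 0 ≤ (vertexBasis σ).coord m w} := by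
  rw [← AffineBasis.convexHull_eq_nonneg_coord, ← chart_comp_vertexBasis, range_comp,
    ← preimage_image_eq (convexHull ℝ _) (chart σ).injective]
  congr 1
  exact ((chart σ).toAffineMap.image_convexHull _).symm

theorem isCompact_preimage_chart_convexHull :
    IsCompact (chart σ ⁻¹' convexHull ℝ (range σ.points)) := by
  rw [preimage_chart_convexHull, ← AffineBasis.convexHull_eq_nonneg_coord]
  exact (finite_range _).isCompact_convexHull (𝕜 := ℝ)

theorem chart_mem_affineSpan_image {J : Set (Fin (k + 1))} {w : directionSpace σ}
    (hw : ∀ m ∉ J, (vertexBasis σ).coord m w = 0) :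
    chart σ w ∈ affineSpan ℝ (σ.points '' J) := by
  have hmem := affineCombination_mem_affineSpan_image (p := vertexBasis σ)
    ((vertexBasis σ).sum_coord_apply_eq_one w) (fun m _ hm => hw m hm)
  rw [AffineBasis.affineCombination_coord_eq_self] at hmem
  rw [← chart_comp_vertexBasis, image_comp]
  exact (AffineSubspace.map_span (chart σ).toAffineMap _).le ⟨w, hmem, rfl⟩

theorem coord_linear_eq_zero_of_mem_vectorSpan {J : Set (Fin (k + 1))} {u : directionSpace σ}
    (hu : (u : E) ∈ vectorSpan ℝ (σ.points '' J)) {m : Fin (k + 1)} (hm : m ∉ J) :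
    ((vertexBasis σ).coord m).linear u = 0 := by
  rw [← chart_comp_vertexBasis, image_comp] at hu
  obtain ⟨u', hu', h⟩ := ((chart σ).toAffineMap.map_vectorSpan).ge hu
  obtain rfl : u' = u := Subtype.ext h
  have hsub : ((vertexBasis σ).coord m '' (vertexBasis σ '' J)).Subsingleton := by
    refine subsingleton_of_subset_singleton (a := 0) ?_
    rintro _ ⟨_, ⟨a, ha, rfl⟩, rfl⟩
    exact (vertexBasis σ).coord_apply_ne fun h => hm (h ▸ ha)
  rw [← Submodule.mem_bot ℝ, ← vectorSpan_of_subsingleton ℝ hsub, ← AffineMap.map_vectorSpan]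
  exact ⟨u', hu', rfl⟩

theorem isAddHaarMeasure_directionSpace [MeasurableSpace E] [BorelSpace E]
    (σ : Affine.Simplex ℝ E k) : (μHE[k] : Measure (directionSpace σ)).IsAddHaarMeasure := by
  have h : (μHE[Module.finrank ℝ (directionSpace σ)] :
    Measure (directionSpace σ)).IsAddHaarMeasure := inferInstance
  rwa [σ.independent.finrank_vectorSpan (Fintype.card_fin _)] at h

end Chart

section Genericity

theorem vectorSpan_range_fin_succ {k V P : Type*} [Ring k] [AddCommGroup V] [Module k V]
    [AddTorsor V P] {n : ℕ} (p : Fin (n + 1) → P) :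
    vectorSpan k (range p) = Submodule.span k (range fun a : Fin n => p a.succ -ᵥ p 0) := by
  rw [vectorSpan_range_eq_span_range_vsub_right k p 0, Fin.range_fin_succ, vsub_self,
    Submodule.span_insert_zero]
  rfl

variable {d N k : ℕ} {y : Fin N → EuclideanSpace ℝ (Fin d)}
  {σ : Affine.Simplex ℝ (EuclideanSpace ℝ (Fin d)) k}

theorem IsGenericFor.orthogonal_inf_vectorSpan_eq_bot (hy : IsGenericFor y σ)
    {I : Finset (Fin N)} {J : Finset (Fin (k + 1))} (hIJ : I.card = J.card) :
    (vectorSpan ℝ (y '' I))ᗮ ⊓ vectorSpan ℝ (σ.points '' J) = ⊥ := by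
  rcases Nat.lt_or_ge 1 J.card with hJ | hJ
  · obtain ⟨l, hl⟩ : ∃ l, J.card = l + 1 := ⟨J.card - 1, by omega⟩
    have hN : l + 1 ≤ N := by simpa [hIJ, hl] using I.card_le_univ
    have hk : l + 1 ≤ k + 1 := by simpa [hl] using J.card_le_univ
    have hd : k ≤ d := by
      simpa [σ.independent.finrank_vectorSpan (Fintype.card_fin _)] using
        Submodule.finrank_le (vectorSpan ℝ (range σ.points))
    have hdim := hy l l (by omega) (by omega) (by omega) (by omega) _ _
      (I.orderEmbOfFin (hIJ.trans hl)).injective (J.orderEmbOfFin hl).injective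
    rw [Nat.sub_self, Submodule.finrank_eq_zero] at hdim
    rwa [← Finset.range_orderEmbOfFin I (hIJ.trans hl), ← Finset.range_orderEmbOfFin J hl,
      ← range_comp, ← range_comp, vectorSpan_range_fin_succ, vectorSpan_range_fin_succ]
  · have hsub : (σ.points '' J).Subsingleton :=
      Set.Subsingleton.image (fun a ha b hb => Finset.card_le_one.1 hJ a ha b hb) _
    rw [vectorSpan_of_subsingleton _ hsub, inf_bot_eq]

theorem mem_orthogonal_vectorSpan_image {E ι : Type*} [NormedAddCommGroup E]
    [InnerProductSpace ℝ E] {y : ι → E} {I : Set ι} {u : E} {κ : ℝ}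
    (hu : ∀ i ∈ I, inner ℝ u (y i) = κ) : u ∈ (vectorSpan ℝ (y '' I))ᗮ := by
  rw [Submodule.mem_orthogonal']
  have hle : vectorSpan ℝ (y '' I) ≤ (innerₛₗ ℝ u).ker := by
    rw [vectorSpan_def, Submodule.span_le]
    rintro _ ⟨_, ⟨i, hi, rfl⟩, _, ⟨j, hj, rfl⟩, rfl⟩
    simp [inner_sub_right, hu i hi, hu j hj]
  exact fun v hv => hle hv

theorem IsGenericFor.exists_direction (hy : IsGenericFor y σ) {I : Finset (Fin N)}
    {J : Finset (Fin (k + 1))} (hIJ : I.card = J.card) (hI : I.Nonempty) (c : Fin N → ℝ) :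
    ∃ u : directionSpace σ, (∀ m ∉ J, ((vertexBasis σ).coord m).linear u = 0) ∧
      ∃ κ, ∀ i ∈ I, inner ℝ (u : EuclideanSpace ℝ (Fin d)) (y i) = c i + κ := by
  classical
  set W := vectorSpan ℝ (σ.points '' J)
  have hW : Module.finrank ℝ W + 1 = J.card := by
    have hpos : 0 < J.card := hIJ ▸ hI.card_pos
    rw [← Nat.sub_add_cancel hpos, ← σ.independent.finrank_vectorSpan_image_finset (s := J)
      (Nat.sub_add_cancel hpos).symm, Finset.coe_image]
  obtain ⟨T, T_apply⟩ : ∃ T : W × ℝ →ₗ[ℝ] (I → ℝ), ∀ p i,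
      T p i = inner ℝ (p.1 : EuclideanSpace ℝ (Fin d)) (y i) - p.2 :=
    ⟨LinearMap.pi fun i => innerₛₗ ℝ (y i) ∘ₗ W.subtype ∘ₗ LinearMap.fst ℝ _ _ -
      LinearMap.snd ℝ _ _, fun p i => by simp [real_inner_comm]⟩
  have T_injective : Function.Injective T := by
    rw [injective_iff_map_eq_zero]
    rintro ⟨u, κ⟩ h
    have huκ : ∀ i ∈ I, inner ℝ (u : EuclideanSpace ℝ (Fin d)) (y i) = κ := fun i hi => by
      rw [← sub_eq_zero, ← T_apply (u, κ) ⟨i, hi⟩, h, Pi.zero_apply]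
    have hu : (u : EuclideanSpace ℝ (Fin d)) = 0 := by
      rw [← Submodule.mem_bot ℝ, ← hy.orthogonal_inf_vectorSpan_eq_bot hIJ]
      exact ⟨mem_orthogonal_vectorSpan_image huκ, u.2⟩
    obtain ⟨i, hi⟩ := hI
    have hκ := huκ i hi
    rw [hu, inner_zero_left] at hκ
    rw [Prod.mk_eq_zero, ← hκ]
    exact ⟨Subtype.ext hu, rfl⟩
  have T_surjective : Function.Surjective T :=
    (LinearMap.injective_iff_surjective_of_finrank_eq_finrank (by simp [hW, hIJ])).1 T_injective
  obtain ⟨⟨u, κ⟩, huκ⟩ := T_surjective fun i => c i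
  refine ⟨⟨u, vectorSpan_mono ℝ (image_subset_range _ _) u.2⟩,
    fun m hm => coord_linear_eq_zero_of_mem_vectorSpan u.2 hm, κ, fun i hi => ?_⟩
  rw [← sub_eq_iff_eq_add, ← T_apply (u, κ) ⟨i, hi⟩, huκ]

end Genericity

section CutForm

variable {E n : Type*} [NormedAddCommGroup E] [InnerProductSpace ℝ E] {k : ℕ}

/-- The power distance to the point `y i` with weight `ψ i`. -/
def powerDist (y : n → E) (ψ : EuclideanSpace ℝ n) (i : n) (x : E) : ℝ := ‖x - y i‖ ^ 2 + ψ i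

variable (σ : Affine.Simplex ℝ E k) (y : n → E) (i : n)

/-- The linear parts of the inequalities that cut the `i`-th Laguerre cell out of a simplex in the
coordinates of `chart σ`: the comparisons of power distances, then the facets of the simplex. -/
noncomputable def cutForm : {j // j ≠ i} ⊕ Fin (k + 1) → directionSpace σ →L[ℝ] ℝ :=
  Sum.elim (fun j => (2 : ℝ) • (innerSL ℝ (y j - y i)).comp (directionSpace σ).subtypeL)
    fun m => -((vertexBasis σ).coord m).linear.toContinuousLinearMap

/-- The offsets of the inequalities with linear parts `cutForm`, as a function of the differences
`a j` of the weights. -/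
noncomputable def cutOffset (a : {j // j ≠ i} → ℝ) : {j // j ≠ i} ⊕ Fin (k + 1) → ℝ :=
  Sum.elim (fun j => a j + (‖σ.points 0 - y j‖ ^ 2 - ‖σ.points 0 - y i‖ ^ 2))
    fun m => (vertexBasis σ).coord m 0

variable {σ y i}

theorem cutForm_inl_apply (j : {j // j ≠ i}) (w : directionSpace σ) :
    cutForm σ y i (Sum.inl j) w = 2 * (inner ℝ (w : E) (y j) - inner ℝ (w : E) (y i)) := by
  simp [cutForm, real_inner_comm (w : E)]

theorem cutForm_inr_apply (m : Fin (k + 1)) (w : directionSpace σ) :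
    cutForm σ y i (Sum.inr m) w = -((vertexBasis σ).coord m).linear w := rfl

theorem cutOffset_sub_cutForm_inl (ψ : EuclideanSpace ℝ n) (j : {j // j ≠ i})
    (w : directionSpace σ) :
    cutOffset σ y i (fun j => ψ j - ψ i) (Sum.inl j) - cutForm σ y i (Sum.inl j) w =
      powerDist y ψ j (chart σ w) - powerDist y ψ i (chart σ w) := by
  simp only [cutForm_inl_apply, cutOffset, Sum.elim_inl, powerDist, chart_apply, add_sub_assoc,
    norm_add_sq_real, inner_sub_right]
  ring

theorem cutOffset_sub_cutForm_inr (a : {j // j ≠ i} → ℝ) (m : Fin (k + 1))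
    (w : directionSpace σ) :
    cutOffset σ y i a (Sum.inr m) - cutForm σ y i (Sum.inr m) w = (vertexBasis σ).coord m w := by
  have h := ((vertexBasis σ).coord m).map_vadd 0 w
  simp only [vadd_eq_add, add_zero] at h
  simp only [cutForm_inr_apply, cutOffset, Sum.elim_inr, h]
  ring

theorem cutOffset_update [DecidableEq n] (a : {j // j ≠ i} → ℝ) (j : {j // j ≠ i}) (t : ℝ) :
    cutOffset σ y i (Function.update a j t) = Function.update (cutOffset σ y i a) (Sum.inl j)
      (t + (‖σ.points 0 - y j‖ ^ 2 - ‖σ.points 0 - y i‖ ^ 2)) := by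
  ext (j' | m)
  · rcases eq_or_ne j' j with rfl | h <;> simp [cutOffset, *]
  · simp [cutOffset]

theorem continuous_cutOffset : Continuous (cutOffset σ y i) := by
  refine continuous_pi fun m => ?_
  rcases m with j | m <;> simp only [cutOffset, Sum.elim_inl, Sum.elim_inr] <;> fun_prop

end CutForm

section GenericCut

variable {d N k : ℕ} {σ : Affine.Simplex ℝ (EuclideanSpace ℝ (Fin d)) k}
  {y : Fin N → EuclideanSpace ℝ (Fin d)} {i : Fin N}

theorem preimage_chart_powerCell_inter (ψ : EuclideanSpace ℝ (Fin N)) :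
    chart σ ⁻¹' (powerCell y ψ i ∩ convexHull ℝ (range σ.points)) =
      polyhedron (cutForm σ y i) (cutOffset σ y i fun j => ψ j - ψ i) := by
  rw [preimage_inter, preimage_chart_convexHull]
  ext w
  simp only [polyhedron, mem_inter_iff, mem_ofPred_eq, Sum.forall, mem_preimage, powerCell]
  refine and_congr ?_ (forall_congr' fun m => ?_)
  · simp only [← sub_nonneg (b := cutForm σ y i _ w), cutOffset_sub_cutForm_inl, sub_nonneg,
      Subtype.forall]
    exact ⟨fun h j _ => h j, fun h j => (eq_or_ne j i).elim (fun hj => hj ▸ le_rfl) (h j)⟩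
  · rw [← cutOffset_sub_cutForm_inr (y := y) fun j => ψ j - ψ i, sub_nonneg]

theorem IsGenericFor.cutForm_inl_ne_zero (hy : IsGenericFor y σ) (hk : 1 ≤ k) (j : {j // j ≠ i}) :
    cutForm σ y i (Sum.inl j) ≠ 0 := by
  obtain ⟨u, -, κ, hκ⟩ := hy.exists_direction (I := {i, ↑j}) (J := {0, Fin.last k})
    (by rw [Finset.card_pair j.2.symm, Finset.card_pair (by simp [Fin.ext_iff]; omega)])
    (by simp) (Pi.single ↑j 1)
  intro h
  have hu := cutForm_inl_apply (y := y) j u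
  rw [h, hκ i (by simp), hκ j (by simp)] at hu
  simp [j.2.symm] at hu

theorem IsGenericFor.exists_cutForm_inl_ne_zero (hy : IsGenericFor y σ) (hk : 2 ≤ k)
    {j j' : {j // j ≠ i}} (hj : j' ≠ j) :
    ∃ w, cutForm σ y i (Sum.inl j) w = 0 ∧ cutForm σ y i (Sum.inl j') w ≠ 0 := by
  have hj' : (j' : Fin N) ≠ j := Subtype.coe_ne_coe.2 hj
  obtain ⟨J, hJ⟩ : ∃ J : Finset (Fin (k + 1)), J.card = 3 := by
    obtain ⟨J, -, hJ⟩ := Finset.exists_subset_card_eq (s := (Finset.univ : Finset (Fin (k + 1))))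
      (n := 3) (by simp; omega)
    exact ⟨J, hJ⟩
  obtain ⟨u, -, κ, hκ⟩ := hy.exists_direction (I := {i, ↑j, ↑j'})
    (by rw [hJ, Finset.card_eq_three.2 ⟨i, j, j', j.2.symm, j'.2.symm, hj'.symm, rfl⟩])
    (by simp) (Pi.single ↑j' 1)
  have hi := hκ i (by simp)
  refine ⟨u, ?_, ?_⟩
  · rw [cutForm_inl_apply, hi, hκ j (by simp)]
    simp [hj'.symm, j'.2.symm]
  · rw [cutForm_inl_apply, hi, hκ j' (by simp)]
    simp [j'.2.symm]

theorem IsGenericFor.exists_cutForm_inr_ne_zero (hy : IsGenericFor y σ) (hk : 2 ≤ k)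
    (j : {j // j ≠ i}) (m : Fin (k + 1)) :
    ∃ w, cutForm σ y i (Sum.inl j) w = 0 ∧ cutForm σ y i (Sum.inr m) w ≠ 0 := by
  obtain ⟨a, ha, b, hb, hab⟩ : ∃ a ∈ Finset.univ.erase m, ∃ b ∈ Finset.univ.erase m, a ≠ b :=
    Finset.one_lt_card.1 (by simp; omega)
  -- Subtracting from an edge through the `m`-th vertex a vector along the edge `[a, b]` does not
  -- change its `m`-th barycentric coordinate.
  set v := vertexBasis σ m - vertexBasis σ a
  have hv : ((vertexBasis σ).coord m).linear v = 1 := by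
    have h := ((vertexBasis σ).coord m).linearMap_vsub (vertexBasis σ m) (vertexBasis σ a)
    rw [vsub_eq_sub] at h
    rw [h, AffineBasis.coord_apply_eq,
      (vertexBasis σ).coord_apply_ne (Finset.ne_of_mem_erase ha).symm, vsub_eq_sub, sub_zero]
  obtain ⟨u, hum, κ, hκ⟩ := hy.exists_direction (I := {i, ↑j}) (J := {a, b})
    (by rw [Finset.card_pair j.2.symm, Finset.card_pair hab]) (by simp)
    fun q => inner ℝ (v : EuclideanSpace ℝ (Fin d)) (y q)
  refine ⟨v - u, ?_, ?_⟩
  · rw [map_sub, cutForm_inl_apply, cutForm_inl_apply, hκ i (by simp), hκ j (by simp)]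
    ring
  · have hm : m ∉ ({a, b} : Finset (Fin (k + 1))) := by
      simp [(Finset.ne_of_mem_erase ha).symm, (Finset.ne_of_mem_erase hb).symm]
    rw [cutForm_inr_apply, map_sub, hv, hum m hm]
    norm_num

theorem IsGenericFor.exists_hasFDerivAt_cutIntegral (hy : IsGenericFor y σ) (hk : 2 ≤ k)
    {f : directionSpace σ → ℝ} (hf : Continuous f) (hfc : HasCompactSupport f)
    (hf₀ : ∀ x, 0 ≤ f x) :
    ∃ g : {j // j ≠ i} → ({j // j ≠ i} → ℝ) → ℝ, (∀ j, Continuous (g j)) ∧ (∀ j a, 0 ≤ g j a) ∧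
      (∀ a, HasFDerivAt (fun a => cutIntegral μHE[k] f (cutForm σ y i) (cutOffset σ y i a))
        (∑ j, g j a • (ContinuousLinearMap.proj j : ({j // j ≠ i} → ℝ) →L[ℝ] ℝ)) a) ∧
      ∀ j a, ∀ w ∈ openFacet (cutForm σ y i) (cutOffset σ y i a) (Sum.inl j),
        0 < f w → 0 < g j a := by
  have := isAddHaarMeasure_directionSpace σ
  choose g hgc hg₀ hgd hgp using fun j : {j // j ≠ i} =>
    exists_hasDerivAt_cutIntegral μHE[k] hf hfc hf₀ (cutForm σ y i) (Sum.inl j)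
      (hy.cutForm_inl_ne_zero (by omega) j) (fun m hm => by
        rcases m with j' | m
        · exact hy.exists_cutForm_inl_ne_zero hk fun h => hm (h ▸ rfl)
        · exact hy.exists_cutForm_inr_ne_zero hk j m)
  have hc : ∀ j, Continuous fun a => g j (cutOffset σ y i a) :=
    fun j => (hgc j).comp continuous_cutOffset
  refine ⟨fun j a => g j (cutOffset σ y i a), hc, fun j a => hg₀ j _,
    hasFDerivAt_of_continuous_partials hc fun j a => ?_, fun j a => hgp j _⟩
  simp only [cutOffset_update]
  exact HasDerivAt.comp_add_const (a j) _ (hgd j (cutOffset σ y i a))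

end GenericCut

section Ties

variable {d N k : ℕ} {σ : Affine.Simplex ℝ (EuclideanSpace ℝ (Fin d)) k}
  {y : Fin N → EuclideanSpace ℝ (Fin d)} {ψ : EuclideanSpace ℝ (Fin N)} {i : Fin N}

/-- The points of the plane of the face `J` of a simplex where the power distances to the points
`y i`, `i ∈ I`, agree. -/
def tieSet (σ : Affine.Simplex ℝ (EuclideanSpace ℝ (Fin d)) k)
    (y : Fin N → EuclideanSpace ℝ (Fin d)) (ψ : EuclideanSpace ℝ (Fin N))
    (I : Finset (Fin N)) (J : Finset (Fin (k + 1))) : Set (EuclideanSpace ℝ (Fin d)) :=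
  {x | x ∈ affineSpan ℝ (σ.points '' J) ∧ ∃ κ, ∀ i ∈ I, powerDist y ψ i x = κ}

theorem IsGenericFor.subsingleton_tieSet (hy : IsGenericFor y σ) (ψ : EuclideanSpace ℝ (Fin N))
    {I : Finset (Fin N)} {J : Finset (Fin (k + 1))} (hIJ : I.card = J.card) :
    (tieSet σ y ψ I J).Subsingleton := by
  rintro x ⟨hx, κ, hκ⟩ x' ⟨hx', κ', hκ'⟩
  have hinner : ∀ i ∈ I, inner ℝ (x - x') (y i) = (‖x‖ ^ 2 - ‖x'‖ ^ 2 - κ + κ') / 2 := by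
    intro i hi
    have h := hκ i hi
    have h' := hκ' i hi
    rw [powerDist, norm_sub_sq_real] at h h'
    rw [inner_sub_left]
    linarith
  rw [← sub_eq_zero, ← Submodule.mem_bot ℝ, ← hy.orthogonal_inf_vectorSpan_eq_bot hIJ]
  exact ⟨mem_orthogonal_vectorSpan_image hinner,
    vsub_mem_vectorSpan_of_mem_affineSpan_of_mem_affineSpan hx hx'⟩

theorem card_lt_card_of_notMem_tieSet {w : directionSpace σ} {κ : ℝ} {I : Finset (Fin N)}
    {J : Finset (Fin (k + 1))} (hI : ∀ i ∈ I, powerDist y ψ i (chart σ w) = κ)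
    (hJ : ∀ m ∉ J, (vertexBasis σ).coord m w = 0)
    (hw : ∀ I J, I.card = J.card → chart σ w ∉ tieSet σ y ψ I J) : I.card < J.card := by
  by_contra! hle
  obtain ⟨I', hI', hcard⟩ := Finset.exists_subset_card_eq hle
  exact hw I' J hcard ⟨chart_mem_affineSpan_image hJ, κ, fun i hi => hI i (hI' hi)⟩

theorem IsGenericFor.exists_inward_direction (hy : IsGenericFor y σ) {I : Finset (Fin N)}
    {J : Finset (Fin (k + 1))} (hIJ : I.card ≤ J.card) (hI : I.Nonempty) (c : Fin N → ℝ) :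
    ∃ u : directionSpace σ, (∀ m ∉ J, 0 < ((vertexBasis σ).coord m).linear u) ∧
      ∃ κ, ∀ i ∈ I, inner ℝ (u : EuclideanSpace ℝ (Fin d)) (y i) = c i + κ := by
  obtain ⟨J', hJ', hcard⟩ := Finset.exists_subset_card_eq hIJ
  obtain ⟨m₀, hm₀⟩ : J.Nonempty := Finset.card_pos.1 (hI.card_pos.trans_le hIJ)
  set v := Finset.univ.centroid ℝ (vertexBasis σ) - vertexBasis σ m₀
  have hv : ∀ m ∉ J, 0 < ((vertexBasis σ).coord m).linear v := by
    intro m hm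
    have h := ((vertexBasis σ).coord m).linearMap_vsub
      (Finset.univ.centroid ℝ (vertexBasis σ)) (vertexBasis σ m₀)
    rw [vsub_eq_sub] at h
    rw [h, (vertexBasis σ).coord_apply_ne (ne_of_mem_of_not_mem hm₀ hm).symm,
      (vertexBasis σ).coord_apply_centroid (Finset.mem_univ m), vsub_eq_sub, sub_zero]
    simp only [Finset.card_univ, Fintype.card_fin]
    positivity
  obtain ⟨t, ht, κ, hκ⟩ := hy.exists_direction hcard.symm hI
    fun i => c i - inner ℝ (v : EuclideanSpace ℝ (Fin d)) (y i)
  refine ⟨v + t, fun m hm => ?_, κ, fun i hi => ?_⟩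
  · rw [map_add, ht m fun h => hm (hJ' h), add_zero]
    exact hv m hm
  · rw [Submodule.coe_add, inner_add_left, hκ i hi]
    ring

theorem IsGenericFor.openFacet_cutForm_nonempty (hy : IsGenericFor y σ) {j : {j // j ≠ i}}
    {w : directionSpace σ}
    (hwi : w ∈ polyhedron (cutForm σ y i) (cutOffset σ y i fun j => ψ j - ψ i))
    (hwj : powerDist y ψ j (chart σ w) = powerDist y ψ i (chart σ w))
    (hw : ∀ I J, I.card = J.card → chart σ w ∉ tieSet σ y ψ I J) :
    (openFacet (cutForm σ y i) (cutOffset σ y i fun j => ψ j - ψ i) (Sum.inl j)).Nonempty := by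
  classical
  set I := Finset.univ.filter fun m => powerDist y ψ m (chart σ w) = powerDist y ψ i (chart σ w)
  set J := Finset.univ.filter fun m => (vertexBasis σ).coord m w ≠ 0
  have hi : i ∈ I := by simp [I]
  have hj : (j : Fin N) ∈ I := by simp [I, hwj]
  have hcard : I.card < J.card :=
    card_lt_card_of_notMem_tieSet (fun m hm => (Finset.mem_filter.1 hm).2)
      (fun m hm => by simpa [J] using hm) hw
  -- Fewer cells meet at the point than the face around it has vertices, so some direction into the
  -- simplex keeps the tie between `i` and `j` and lets both win against the other tied cells.
  obtain ⟨u, hu, κ, hκ⟩ := hy.exists_inward_direction hcard.le ⟨i, hi⟩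
    fun m => if m = i ∨ m = j then 0 else -1
  refine openFacet_nonempty_of_direction (u := u) hwi ?_ ?_ ?_
  · rw [eq_comm, ← sub_eq_zero, cutOffset_sub_cutForm_inl, hwj, sub_self]
  · rw [cutForm_inl_apply, hκ i hi, hκ j hj]
    simp
  · rintro (m | m) hmj hm
    · have hmI : (m : Fin N) ∈ I := by
        rw [eq_comm, ← sub_eq_zero, cutOffset_sub_cutForm_inl, sub_eq_zero] at hm
        simp [I, hm]
      have hne : (m : Fin N) ≠ j := fun h => hmj (congrArg Sum.inl (Subtype.ext h))
      rw [cutForm_inl_apply, hκ i hi, hκ m hmI]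
      simp [hne, m.2]
    · rw [eq_comm, ← sub_eq_zero, cutOffset_sub_cutForm_inr] at hm
      rw [cutForm_inr_apply, neg_lt_zero]
      exact hu m (by simp [J, hm])

end Ties

section Adjacency

variable {d N : ℕ} {ι : Type*} {S : SimplexSoup d ι} {y : Fin N → EuclideanSpace ℝ (Fin d)}
  {ψ : EuclideanSpace ℝ (Fin N)}

theorem isCompact_cell (s : ι) : IsCompact (S.cell s) :=
  (finite_range (S.simplex s).points).isCompact_convexHull (𝕜 := ℝ)

theorem isCompact_support [Finite ι] : IsCompact S.support := isCompact_iUnion isCompact_cell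

theorem isClosed_powerCell (i : Fin N) : IsClosed (powerCell y ψ i) := by
  simp only [powerCell, ofPred_forall]
  exact isClosed_iInter fun j => isClosed_le (by fun_prop) (by fun_prop)

theorem isClosed_laguerreCell [Finite ι] (i : Fin N) : IsClosed (laguerreCell S y ψ i) :=
  (isClosed_powerCell i).inter isCompact_support.isClosed

theorem iUnion_laguerreCell [NeZero N] : ⋃ i, laguerreCell S y ψ i = S.support := by
  refine subset_antisymm (iUnion_subset fun i => inter_subset_right) fun x hx => ?_
  obtain ⟨i, hi⟩ := Finite.exists_min fun i => powerDist y ψ i x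
  exact mem_iUnion.2 ⟨i, hi, hx⟩

/-- The cells of `i` and `j` meet in the relative interior of a simplex of the soup, at a point that
lies in no other cell. -/
def CellsAdjacent (S : SimplexSoup d ι) (y : Fin N → EuclideanSpace ℝ (Fin d))
    (ψ : EuclideanSpace ℝ (Fin N)) (i : Fin N) (j : {j // j ≠ i}) : Prop :=
  ∃ s, (openFacet (cutForm (S.simplex s) y i)
    (cutOffset (S.simplex s) y i fun j => ψ j - ψ i) (Sum.inl j)).Nonempty

theorem IsGeneric.cellsAdjacent (hy : IsGeneric y S) {i j : Fin N} (hij : j ≠ i)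
    {x : EuclideanSpace ℝ (Fin d)} (hxi : x ∈ laguerreCell S y ψ i)
    (hxj : x ∈ laguerreCell S y ψ j)
    (hx : ∀ s I J, I.card = J.card → x ∉ tieSet (S.simplex s) y ψ I J) :
    CellsAdjacent S y ψ i ⟨j, hij⟩ := by
  obtain ⟨s, hs⟩ := mem_iUnion.1 hxi.2
  obtain ⟨w, rfl⟩ := mem_range_chart_of_mem_affineSpan (convexHull_subset_affineSpan _ hs)
  refine ⟨s, (hy s).openFacet_cutForm_nonempty ?_ (le_antisymm (hxj.1 i) (hxi.1 j)) (hx s)⟩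
  rw [← preimage_chart_powerCell_inter]
  exact ⟨hxi.1, hs⟩

theorem IsGeneric.exists_cellsAdjacent [Finite ι] (hy : IsGeneric y S)
    (hS : ∀ F ⊆ S.support, F.Finite → IsPreconnected (S.support \ F))
    (hψ : ∀ i, (laguerreCell S y ψ i).Infinite) {P : Set (Fin N)} (hP : P.Nonempty)
    (hP' : Pᶜ.Nonempty) : ∃ i ∈ P, ∃ j : {j // j ≠ i}, ↑j ∉ P ∧ CellsAdjacent S y ψ i j := by
  set F := S.support ∩ ⋃ s, ⋃ I : Finset (Fin N), ⋃ J : Finset (Fin (S.dim s + 1)),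
    ⋃ _ : I.card = J.card, tieSet (S.simplex s) y ψ I J
  have hF : F.Finite := (finite_iUnion fun s => finite_iUnion fun I => finite_iUnion fun J =>
    finite_iUnion fun h => ((hy s).subsingleton_tieSet ψ h).finite).subset inter_subset_right
  have hclosed : ∀ Q : Set (Fin N), IsClosed (⋃ i ∈ Q, laguerreCell S y ψ i) := fun Q =>
    Q.toFinite.isClosed_biUnion fun i _ => isClosed_laguerreCell i
  have hmeet : ∀ Q : Set (Fin N), Q.Nonempty →
      ((S.support \ F) ∩ ⋃ i ∈ Q, laguerreCell S y ψ i).Nonempty := by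
    rintro Q ⟨i, hi⟩
    obtain ⟨x, hx, hxF⟩ := (hψ i).exists_notMem_finite hF
    exact ⟨x, ⟨hx.2, hxF⟩, mem_iUnion₂.2 ⟨i, hi, hx⟩⟩
  have hcover : S.support \ F ⊆
      (⋃ i ∈ P, laguerreCell S y ψ i) ∪ ⋃ i ∈ Pᶜ, laguerreCell S y ψ i := by
    have : NeZero N := ⟨fun h => by subst h; exact hP.some.elim0⟩
    rw [← biUnion_union, union_compl_self, biUnion_univ, iUnion_laguerreCell]
    exact sdiff_subset
  obtain ⟨x, ⟨hxS, hxF⟩, hxP, hxP'⟩ := isPreconnected_closed_iff.1 (hS F inter_subset_left hF) _ _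
    (hclosed P) (hclosed Pᶜ) hcover (hmeet P hP) (hmeet Pᶜ hP')
  obtain ⟨i, hi, hxi⟩ := mem_iUnion₂.1 hxP
  obtain ⟨j, hj, hxj⟩ := mem_iUnion₂.1 hxP'
  refine ⟨i, hi, ⟨j, fun h => hj (h ▸ hi)⟩, hj, hy.cellsAdjacent _ hxi hxj ?_⟩
  exact fun s I J hIJ hx =>
    hxF ⟨hxS, mem_iUnion.2 ⟨s, mem_iUnion.2 ⟨I, mem_iUnion₂.2 ⟨J, hIJ, hx⟩⟩⟩⟩

end Adjacency

section GraphLaplacian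

variable {n : Type*} [Fintype n] [DecidableEq n]

/-- The Laplacian `v ↦ (∑ j, w i j (v j - v i))_i` of a weighted directed graph without loops. -/
noncomputable def graphLaplacian (w : (i : n) → {j // j ≠ i} → ℝ) :
    EuclideanSpace ℝ n →L[ℝ] EuclideanSpace ℝ n :=
  ((EuclideanSpace.equiv n ℝ).symm : (n → ℝ) →L[ℝ] EuclideanSpace ℝ n).comp <|
    ContinuousLinearMap.pi fun i =>
      ∑ j, w i j • (EuclideanSpace.proj (j : n) - EuclideanSpace.proj i)

theorem graphLaplacian_apply (w : (i : n) → {j // j ≠ i} → ℝ) (v : EuclideanSpace ℝ n) (i : n) :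
    graphLaplacian w v i = ∑ j, w i j * (v j - v i) := by
  simp [graphLaplacian]

theorem continuous_graphLaplacian {X : Type*} [TopologicalSpace X]
    {w : X → (i : n) → {j // j ≠ i} → ℝ} (hw : ∀ i j, Continuous fun x => w x i j) :
    Continuous fun x => graphLaplacian (w x) := by
  refine continuous_clm_apply.2 fun v => ?_
  rw [← (EuclideanSpace.equiv n ℝ).comp_continuous_iff]
  refine continuous_pi fun i => ?_
  change Continuous fun x => graphLaplacian (w x) v i
  simp only [graphLaplacian_apply]
  exact continuous_finsetSum _ fun j _ => (hw i j).mul continuous_const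

theorem ker_graphLaplacian_le {w : (i : n) → {j // j ≠ i} → ℝ} (hw : ∀ i j, 0 ≤ w i j)
    (hconn : ∀ P : Set n, P.Nonempty → Pᶜ.Nonempty → ∃ i ∈ P, ∃ j, ↑j ∉ P ∧ 0 < w i j) :
    (graphLaplacian w).ker ≤ ℝ ∙ ones n := by
  intro v hv
  rw [mem_span_ones_iff]
  intro i₁ i₂
  have : Nonempty n := ⟨i₁⟩
  obtain ⟨m, hm⟩ := Finite.exists_max v
  suffices h : ∀ i, v i = v m by rw [h i₁, h i₂]
  -- The sum `∑ j, w i j (v j - v i)` of nonpositive terms at a maximum `i` of `v` vanishes.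
  by_contra! hne
  obtain ⟨i, hi, j, hj, hij⟩ := hconn {i | v i = v m} ⟨m, rfl⟩ hne
  have hi : v i = v m := hi
  have hterm : ∀ j, w i j * (v j - v i) ≤ 0 := fun j =>
    mul_nonpos_of_nonneg_of_nonpos (hw i j) (by rw [hi]; exact sub_nonpos.2 (hm j))
  have hsum : ∑ j, w i j * (v j - v i) = 0 := by
    rw [← graphLaplacian_apply, show graphLaplacian w v = 0 from hv, PiLp.zero_apply]
  have hzero := (Finset.sum_eq_zero_iff_of_nonpos fun j _ => hterm j).1 hsum j (Finset.mem_univ j)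
  exact hj (hi ▸ sub_eq_zero.1 ((mul_eq_zero.1 hzero).resolve_left hij.ne'))

end GraphLaplacian

section Mass

variable {d N : ℕ} {ι : Type*} {M : SimplicialMeasure d ι} {y : Fin N → EuclideanSpace ℝ (Fin d)}
  {ψ : EuclideanSpace ℝ (Fin N)}

theorem exists_continuous_hasCompactSupport_eqOn {X : Type*} [TopologicalSpace X] [NormalSpace X]
    [T2Space X] [LocallyCompactSpace X] {P : Set X} (hP : IsCompact P) {g : X → ℝ}
    (hg : ContinuousOn g P) (hg₀ : ∀ x ∈ P, 0 ≤ g x) :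
    ∃ f : X → ℝ, Continuous f ∧ HasCompactSupport f ∧ (∀ x, 0 ≤ f x) ∧ EqOn f g P := by
  obtain ⟨h, hh⟩ := ContinuousMap.exists_restrict_eq hP.isClosed
    ⟨_, continuousOn_iff_continuous_domRestrict.1 hg⟩
  obtain ⟨χ, hχ₁, -, hχc, hχ⟩ := exists_continuous_one_zero_of_isCompact hP isClosed_empty
    (disjoint_empty P)
  refine ⟨fun x => χ x * |h x|, by fun_prop, hχc.mul_right,
    fun x => mul_nonneg (hχ x).1 (abs_nonneg _), fun x hx => ?_⟩
  have hhx : h x = g x := congrArg (fun f => f ⟨x, hx⟩) hh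
  simp only [hχ₁ hx, Pi.one_apply, one_mul, hhx, abs_of_nonneg (hg₀ x hx)]

theorem measurableEmbedding_chart {k : ℕ}
    (σ : Affine.Simplex ℝ (EuclideanSpace ℝ (Fin d)) k) : MeasurableEmbedding (chart σ) :=
  (chart σ).isometry.isClosedEmbedding.measurableEmbedding

variable [Fintype ι]

theorem toMeasure_apply {B : Set (EuclideanSpace ℝ (Fin d))} (hB : MeasurableSet B) :
    M.toMeasure B = ∑ s, ∫⁻ w in chart (M.soup.simplex s) ⁻¹' (B ∩ M.soup.cell s),
      ENNReal.ofReal (M.density s (chart (M.soup.simplex s) w)) ∂μHE[M.soup.dim s] := by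
  rw [SimplicialMeasure.toMeasure, Measure.finsetSum_apply]
  refine Finset.sum_congr rfl fun s _ => ?_
  have hchart := measurableEmbedding_chart (M.soup.simplex s)
  have hsub : B ∩ M.soup.cell s ⊆ range (chart (M.soup.simplex s)) := fun x hx =>
    mem_range_chart_of_mem_affineSpan (convexHull_subset_affineSpan _ hx.2)
  rw [withDensity_apply _ hB, Measure.restrict_restrict hB,
    ← hchart.lintegral_map fun x => ENNReal.ofReal (M.density s x), ← hchart.restrict_map,
    (chart (M.soup.simplex s)).isometry.map_euclideanHausdorffMeasure,
    Measure.restrict_restrict (hB.inter (isCompact_cell s).measurableSet), inter_eq_left.2 hsub]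

theorem toMeasure_eq_zero {B : Set (EuclideanSpace ℝ (Fin d))} (hB : MeasurableSet B)
    (h : ∀ s, ∀ᵐ w ∂μHE[M.soup.dim s], chart (M.soup.simplex s) w ∈ M.soup.cell s →
      chart (M.soup.simplex s) w ∉ B) : M.toMeasure B = 0 := by
  rw [toMeasure_apply hB]
  refine Finset.sum_eq_zero fun s _ => setLIntegral_measure_zero _ _ ?_
  exact measure_eq_zero_iff_ae_notMem.2 ((h s).mono fun w hw hBw => hw hBw.2 hBw.1)

theorem toMeasure_support [IsProbabilityMeasure M.toMeasure] : M.toMeasure M.soup.support = 1 := by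
  rw [← prob_compl_eq_zero_iff isCompact_support.measurableSet]
  exact toMeasure_eq_zero isCompact_support.measurableSet.compl fun s =>
    Eventually.of_forall fun w hw => not_not.2 (mem_iUnion.2 ⟨s, hw⟩)

theorem toMeasure_eq_zero_of_finite (hM : M.IsRegular) {F : Set (EuclideanSpace ℝ (Fin d))}
    (hF : F.Finite) : M.toMeasure F = 0 := by
  refine toMeasure_eq_zero hF.measurableSet fun s => ?_
  have := isAddHaarMeasure_directionSpace (M.soup.simplex s)
  have : Nontrivial (directionSpace (M.soup.simplex s)) := by
    rw [← Module.finrank_pos_iff (R := ℝ),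
      (M.soup.simplex s).independent.finrank_vectorSpan (Fintype.card_fin _)]
    exact two_pos.trans_le (hM.two_le_dim s)
  filter_upwards [(hF.preimage (chart (M.soup.simplex s)).injective.injOn).countable.ae_notMem
    μHE[M.soup.dim s]] with w hw _ using hw

theorem toMeasure_laguerreCell_inter_eq_zero (hM : M.IsRegular) (hy : IsGeneric y M.soup)
    {i j : Fin N} (hij : j ≠ i) :
    M.toMeasure (laguerreCell M.soup y ψ i ∩ laguerreCell M.soup y ψ j) = 0 := by
  refine toMeasure_eq_zero
    ((isClosed_laguerreCell i).inter (isClosed_laguerreCell j)).measurableSet fun s => ?_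
  have := isAddHaarMeasure_directionSpace (M.soup.simplex s)
  have hne := (hy s).cutForm_inl_ne_zero (one_le_two.trans (hM.two_le_dim s)) ⟨j, hij⟩
  filter_upwards [ae_apply_ne μHE[M.soup.dim s] hne (cutOffset (M.soup.simplex s) y i
    (fun j => ψ j - ψ i) (Sum.inl ⟨j, hij⟩))] with w hw _ hwB
  apply hw
  rw [eq_comm, ← sub_eq_zero, cutOffset_sub_cutForm_inl, sub_eq_zero]
  exact le_antisymm (hwB.2.1 i) (hwB.1.1 j)

theorem massMap_apply (ψ : EuclideanSpace ℝ (Fin N)) (i : Fin N) :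
    massMap M y ψ i = M.toMeasure.real (laguerreCell M.soup y ψ i) := rfl

theorem sum_massMap [IsProbabilityMeasure M.toMeasure] [NeZero N] (hM : M.IsRegular)
    (hy : IsGeneric y M.soup) (ψ : EuclideanSpace ℝ (Fin N)) : ∑ i, massMap M y ψ i = 1 := by
  have h := measureReal_biUnion_finset₀ (μ := M.toMeasure) (s := Finset.univ)
    (f := laguerreCell M.soup y ψ)
    (fun i _ j _ hij => toMeasure_laguerreCell_inter_eq_zero hM hy hij.symm)
    fun i _ => (isClosed_laguerreCell i).nullMeasurableSet
  simp only [massMap_apply]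
  rw [← h]
  simp only [Finset.mem_univ, iUnion_true, iUnion_laguerreCell, Measure.real, toMeasure_support,
    ENNReal.toReal_one]

theorem massMap_add_smul_ones (ψ : EuclideanSpace ℝ (Fin N)) (c : ℝ) :
    massMap M y (ψ + c • ones (Fin N)) = massMap M y ψ := by
  simp [massMap, laguerreCell, powerCell, ones_apply, ← add_assoc]

theorem infinite_laguerreCell (hM : M.IsRegular) {i : Fin N} (hi : 0 < massMap M y ψ i) :
    (laguerreCell M.soup y ψ i).Infinite := fun h => by
  simp [massMap_apply, Measure.real, toMeasure_eq_zero_of_finite hM h] at hi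

theorem sub_le_of_mem_powerCell {r : ℝ} {x : EuclideanSpace ℝ (Fin d)} (hx : ‖x‖ ≤ r) {i : Fin N}
    (hxi : x ∈ powerCell y ψ i) (j : Fin N) : ψ i - ψ j ≤ (r + ∑ j, ‖y j‖) ^ 2 := by
  have hdist : ‖x - y j‖ ≤ r + ∑ j, ‖y j‖ := (norm_sub_le _ _).trans <|
    add_le_add hx (Finset.single_le_sum (fun j _ => norm_nonneg (y j)) (Finset.mem_univ j))
  calc ψ i - ψ j ≤ ‖x - y j‖ ^ 2 := by linarith [hxi j, sq_nonneg ‖x - y i‖]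
    _ ≤ (r + ∑ j, ‖y j‖) ^ 2 := by gcongr

theorem exists_sub_le_of_massMap_pos (hM : M.IsRegular) :
    ∃ R : ℝ, ∀ ψ, (∀ i, 0 < massMap M y ψ i) → ∀ i j, ψ i - ψ j ≤ R := by
  obtain ⟨r, hr⟩ := (isCompact_support (S := M.soup)).isBounded.exists_norm_le
  refine ⟨(r + ∑ j, ‖y j‖) ^ 2, fun ψ hψ i j => ?_⟩
  obtain ⟨x, hx⟩ := (infinite_laguerreCell hM (hψ i)).nonempty
  exact sub_le_of_mem_powerCell (hr x hx.2) hx.1 j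

theorem massMap_apply_eq_sum_cutIntegral {f : ∀ s, directionSpace (M.soup.simplex s) → ℝ}
    (hf : ∀ s, Continuous (f s)) (hfc : ∀ s, HasCompactSupport (f s)) (hf₀ : ∀ s w, 0 ≤ f s w)
    (hfM : ∀ s, EqOn (f s) (M.density s ∘ chart (M.soup.simplex s))
      (chart (M.soup.simplex s) ⁻¹' M.soup.cell s))
    (ψ : EuclideanSpace ℝ (Fin N)) (i : Fin N) :
    massMap M y ψ i = ∑ s, cutIntegral μHE[M.soup.dim s] (f s) (cutForm (M.soup.simplex s) y i)
      (cutOffset (M.soup.simplex s) y i fun j => ψ j - ψ i) := by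
  have hint : ∀ s, ∫⁻ w in chart (M.soup.simplex s) ⁻¹' (laguerreCell M.soup y ψ i ∩ M.soup.cell s),
      ENNReal.ofReal (M.density s (chart (M.soup.simplex s) w)) ∂μHE[M.soup.dim s] =
      ENNReal.ofReal (cutIntegral μHE[M.soup.dim s] (f s) (cutForm (M.soup.simplex s) y i)
        (cutOffset (M.soup.simplex s) y i fun j => ψ j - ψ i)) := fun s => by
    have := isAddHaarMeasure_directionSpace (M.soup.simplex s)
    have hsub : M.soup.cell s ⊆ M.soup.support := subset_iUnion M.soup.cell s
    have hcell : laguerreCell M.soup y ψ i ∩ M.soup.cell s = powerCell y ψ i ∩ M.soup.cell s := by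
      rw [laguerreCell, inter_assoc, inter_eq_right.2 hsub]
    have hmeas : MeasurableSet
        (chart (M.soup.simplex s) ⁻¹' (powerCell y ψ i ∩ M.soup.cell s)) :=
      (measurableEmbedding_chart _).measurable
        ((isClosed_powerCell i).inter (isCompact_cell s).isClosed).measurableSet
    rw [hcell, cutIntegral, ← preimage_chart_powerCell_inter,
      ofReal_integral_eq_lintegral_ofReal
        ((hf s).integrable_of_hasCompactSupport (hfc s)).integrableOn
        (Eventually.of_forall (hf₀ s))]
    exact setLIntegral_congr_fun hmeas fun w hw => congrArg ENNReal.ofReal (hfM s hw.2).symm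
  rw [massMap_apply, Measure.real, toMeasure_apply (isClosed_laguerreCell i).measurableSet,
    Finset.sum_congr rfl fun s _ => hint s, ENNReal.toReal_sum fun s _ => ENNReal.ofReal_ne_top]
  exact Finset.sum_congr rfl fun s _ => ENNReal.toReal_ofReal (integral_nonneg (hf₀ s))

theorem exists_hasFDerivAt_massMap_apply (hM : M.IsRegular) (hy : IsGeneric y M.soup) (i : Fin N) :
    ∃ g : {j // j ≠ i} → EuclideanSpace ℝ (Fin N) → ℝ, (∀ j, Continuous (g j)) ∧
      (∀ j ψ, 0 ≤ g j ψ) ∧ (∀ ψ, HasFDerivAt (fun ψ => massMap M y ψ i)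
        (∑ j, g j ψ • (EuclideanSpace.proj (j : Fin N) - EuclideanSpace.proj i :
          EuclideanSpace ℝ (Fin N) →L[ℝ] ℝ)) ψ) ∧
      ∀ j ψ, CellsAdjacent M.soup y ψ i j → 0 < g j ψ := by
  choose f hf hfc hf₀ hfM using fun s => exists_continuous_hasCompactSupport_eqOn
    (isCompact_preimage_chart_convexHull (σ := M.soup.simplex s))
    ((hM.continuousOn_density s).comp (chart (M.soup.simplex s)).continuous.continuousOn
      (mapsTo_preimage _ _)) fun w hw => M.density_nonneg s _ hw
  choose g hg hg₀ hgd hgp using fun s => (hy s).exists_hasFDerivAt_cutIntegral (i := i)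
    (hM.two_le_dim s) (hf s) (hfc s) (hf₀ s)
  obtain ⟨D, hD⟩ : ∃ D : EuclideanSpace ℝ (Fin N) →L[ℝ] ({j // j ≠ i} → ℝ), ∀ ψ,
      D ψ = fun j : {j // j ≠ i} => ψ j - ψ i :=
    ⟨ContinuousLinearMap.pi fun j => EuclideanSpace.proj (j : Fin N) - EuclideanSpace.proj i,
      fun ψ => by ext j; simp⟩
  refine ⟨fun j ψ => ∑ s, g s j (D ψ), fun j => continuous_finsetSum _ fun s _ =>
    (hg s j).comp D.continuous, fun j ψ => Finset.sum_nonneg fun s _ => hg₀ s j _,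
    fun ψ => ?_, ?_⟩
  · simp only [massMap_apply_eq_sum_cutIntegral hf hfc hf₀ hfM]
    simp only [← hD]
    refine (HasFDerivAt.fun_sum (u := Finset.univ) fun s _ =>
      (hgd s (D ψ)).comp ψ D.hasFDerivAt).congr_fderiv ?_
    ext v
    simp only [_root_.sum_apply, ContinuousLinearMap.comp_apply, _root_.smul_apply,
      ContinuousLinearMap.proj_apply, hD, Finset.sum_smul]
    exact Finset.sum_comm
  · rintro j ψ ⟨s, w, hw⟩
    have hcell := openFacet_subset_polyhedron _ _ _ hw
    rw [← preimage_chart_powerCell_inter] at hcell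
    obtain ⟨b, hb, hbM⟩ := hM.density_pos s
    refine Finset.sum_pos' (fun s _ => hg₀ s j _) ⟨s, Finset.mem_univ s, ?_⟩
    rw [hD]
    exact hgp s j _ w hw ((hb.trans_le (hbM _ hcell.2)).trans_eq (hfM s hcell.2).symm)

theorem exists_hasFDerivAt_massMap (hM : M.IsRegular) (hy : IsGeneric y M.soup) :
    ∃ g : (i : Fin N) → {j // j ≠ i} → EuclideanSpace ℝ (Fin N) → ℝ,
      (∀ i j, Continuous (g i j)) ∧ (∀ i j ψ, 0 ≤ g i j ψ) ∧
      (∀ ψ, HasFDerivAt (massMap M y) (graphLaplacian fun i j => g i j ψ) ψ) ∧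
      ∀ i j ψ, CellsAdjacent M.soup y ψ i j → 0 < g i j ψ := by
  choose g hg hg₀ hgd hgp using fun i : Fin N => exists_hasFDerivAt_massMap_apply hM hy i
  refine ⟨g, hg, hg₀, fun ψ => ?_, hgp⟩
  rw [← hasFDerivWithinAt_univ, hasFDerivWithinAt_euclidean]
  exact fun i => (hgd i ψ).hasFDerivWithinAt

theorem isMassLike_massMap [IsProbabilityMeasure M.toMeasure] [NeZero N] (hM : M.IsRegular)
    (hy : IsGeneric y M.soup) : IsMassLike (massMap M y) := by
  obtain ⟨g, hg, hg₀, hgd, hgp⟩ := exists_hasFDerivAt_massMap hM hy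
  have hfderiv : fderiv ℝ (massMap M y) = fun ψ => graphLaplacian fun i j => g i j ψ :=
    funext fun ψ => (hgd ψ).fderiv
  refine ⟨contDiff_one_iff_fderiv.2 ⟨fun ψ => (hgd ψ).differentiableAt, ?_⟩,
    massMap_add_smul_ones, sum_massMap hM hy, fun ψ hψ => ?_, exists_sub_le_of_massMap_pos hM⟩
  · rw [hfderiv]
    exact continuous_graphLaplacian hg
  · rw [hfderiv]
    refine ker_graphLaplacian_le (fun i j => hg₀ i j ψ) fun P hP hP' => ?_
    obtain ⟨i, hi, j, hj, hij⟩ := hy.exists_cellsAdjacent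
      (fun F hFS hF => (hM.isConnected_diff F hFS hF).isPreconnected)
      (fun i => infinite_laguerreCell hM (hψ i)) hP hP'
    exact ⟨i, hi, j, hj, hgp i j ψ hij⟩

end Mass

end SemiDiscrete

theorem mainTheorem1 {d N : ℕ} {ι : Type*} [Fintype ι]
    (M : SimplicialMeasure d ι) [IsProbabilityMeasure M.toMeasure] (hM : M.IsRegular)
    (y : Fin N → EuclideanSpace ℝ (Fin d)) (hy : IsGeneric y M.soup)
    (ν : EuclideanSpace ℝ (Fin N)) (hν_nonneg : ∀ i, 0 ≤ ν i) (hν_sum : ∑ i, ν i = 1)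
    (ε₀ : ℝ) (hε₀ : 0 < ε₀) :
    ∃ τ : ℝ, 0 < τ ∧ τ ≤ 1 ∧
      ∀ ψ₀ : EuclideanSpace ℝ (Fin N),
        ε₀ = 1 / 2 * min (⨅ i, massMap M y ψ₀ i) (⨅ i, ν i) →
        ∀ η : ℝ, 0 < η →
          ∃ T : ℕ,
            (∃ ψ : ℕ → EuclideanSpace ℝ (Fin N),
              IsDampedNewtonRun (massMap M y) ν ε₀ η ψ₀ T ψ ∧
              ‖massMap M y (ψ T) - ν‖ < η) ∧
            ∀ (n : ℕ) (ψ : ℕ → EuclideanSpace ℝ (Fin N)),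
              IsDampedNewtonRun (massMap M y) ν ε₀ η ψ₀ n ψ →
              n ≤ T ∧ ∀ k < n,
                ‖massMap M y (ψ (k + 1)) - ν‖ ≤ (1 - τ / 2) * ‖massMap M y (ψ k) - ν‖ := by
  have hN : NeZero N := ⟨fun h => by subst h; simp at hν_sum⟩
  by_cases hν₂ : ∀ i, 2 * ε₀ ≤ ν i
  · obtain ⟨τ, hτ, hτ₁, hconv⟩ :=
      (isMassLike_massMap hM hy).exists_dampedNewton_converges hν_sum hε₀ hν₂
    refine ⟨τ, hτ, hτ₁, fun ψ₀ hψ₀ => hconv ψ₀ fun i => ?_⟩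
    have hmin := min_le_left (⨅ i, massMap M y ψ₀ i) (⨅ i, ν i)
    have hinf : ⨅ i, massMap M y ψ₀ i ≤ massMap M y ψ₀ i :=
      ciInf_le (Set.finite_range _).bddBelow i
    linarith
  · push Not at hν₂
    obtain ⟨i, hi⟩ := hν₂
    refine ⟨1, one_pos, le_rfl, fun ψ₀ hψ₀ => absurd hi (not_lt.2 ?_)⟩
    have hmin := min_le_right (⨅ i, massMap M y ψ₀ i) (⨅ i, ν i)
    have hinf : ⨅ i, ν i ≤ ν i := ciInf_le (Set.finite_range _).bddBelow i
    linarith
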